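/- **Theorem 1.3 (Graded local-global principle).** Let $R=R_0\oplus R_1\oplus R_2\oplus\cdots$ be a graded associative ring with identity, with an involution $a\mapsto\bar a$ such that $\overline{R_i}\subseteq R_i$ for all $i$; let $\lambda\in R_0$ be central in $R$ with $\lambda\bar\lambda=1$, and let $\Lambda$ be a graded $\lambda$-form parameter: an additive subgroup of $R$ with $\{a-\lambda\bar a\mid a\in R\}\subseteq\Lambda\subseteq\{a\in R\mid a=-\lambda\bar a\}$ and $\bar x\Lambda x\subseteq\Lambda$ for all $x\in R$, which contains the homogeneous components of each of its elements. Assume that the center $C(R_0)$ of $R_0$ is contained in the center of $R$. Notation. For a form ring $(R,\Lambda)$ let $\psi_n=\begin{pmatrix}0&I_n\\ \lambda I_n&0\end{pmatrix}$ and $\mathrm{GQ}(2n,R,\Lambda)=\{\sigma\in \mathrm{GL}(2n,R)\mid \sigma^*\psi_n\sigma=\psi_n\}$, where $\sigma^*$ is the conjugate transpose. With $\rho(i)=n+i$ and matrix units $e_{kl}$, let $\mathrm{EQ}(2n,R,\Lambda)$ be the subgroup generated by the matrices, for $1\le i\neq j\le n$ and $a\in R$, $$I_{2n}+a e_{ij}-\bar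 a e_{\rho(j)\rho(i)},\qquad I_{2n}+a e_{i\rho(j)}-\bar\lambda\bar a e_{j\rho(i)},\qquad I_{2n}+a e_{\rho(i)j}-\lambda\bar a e_{\rho(j)i},$$ together with $I_{2n}+a e_{i\rho(i)}$ for $\bar a\in\Lambda$ and $I_{2n}+a e_{\rho(i)i}$ for $a\in\Lambda$, $1\le i\le n$. For a maximal ideal $\mathfrak m$ of $C(R_0)$ let $S_{\mathfrak m}=\{s\in C(R_0)\mid s\notin\mathfrak m,\ \bar s\notin\mathfrak m\}$ (so $S_{\mathfrak m}=C(R_0)\setminus\mathfrak m$ whenever $\overline{\mathfrak m}=\mathfrak m$), let $R_{\mathfrak m}=S_{\mathfrak m}^{-1}R$ with the involution $\overline{a/s}=\bar a/\bar s$, and let $\Lambda_{\mathfrak m}=\{a/(\bar s s)\mid a\in\Lambda,\ s\in S_{\mathfrak m}\}$, the form parameter on $R_{\mathfrak m}$ generated by the image of $\Lambda$. Write $\alpha_{\mathfrak m}$ for the image of $\alpha$ over $R_{\mathfrak m}$, and $R_+=R_1\oplus R_2\oplus\cdots$. Claim. Let $2n\ge 6$ and let $\alpha\in\mathrm{GQ}(2n,R,\Lambda)$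 satisfy $\alpha\equiv I_{2n}\pmod{R_+}$. If $\alpha_{\mathfrak m}\in \mathrm{EQ}(2n,R_{\mathfrak m},\Lambda_{\mathfrak m})$ for every maximal ideal $\mathfrak m$ of $C(R_0)$, then $\alpha\in \mathrm{EQ}(2n,R,\Lambda)$. -/

import Mathlib

/-! Form rings, Bak's quadratic groups and their elementary subgroups, and localization of a graded
form ring at the maximal ideals of the centre of its degree zero part.  An involution on a ring `R`
is a `StarRing R` structure: an additive anti-automorphism of order two. -/

section FormRings

/-- A `lam`-form parameter on a ring with involution: an additive subgroup `Λ` with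
`Λ_min ⊆ Λ ⊆ Λ_max` and `x̄ Λ x ⊆ Λ` for all `x`. -/
structure FormParameter {R : Type*} [Ring R] [StarRing R] (lam : R) extends AddSubgroup R where
  min_le : ∀ a : R, a - lam * star a ∈ carrier
  le_max : ∀ a ∈ carrier, a = -(lam * star a)
  conj_mem : ∀ (x : R), ∀ a ∈ carrier, star x * a * x ∈ carrier

/-- The matrix `ψ_n = (0, I; lam I, 0)`. Rows and columns `1, …, n` are `Sum.inl i`, and
`ρ(i) = n + i` is `Sum.inr i`. -/
def formMatrix {R : Type*} [Ring R] (lam : R) (n : ℕ) : Matrix (Fin n ⊕ Fin n) (Fin n ⊕ Fin n) R :=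
  Matrix.fromBlocks 0 1 (Matrix.diagonal fun _ => lam) 0

/-- Bak's general quadratic group `GQ(2n, R, Λ)`: all invertible `2n × 2n` matrices `σ` with
`σ^* ψ_n σ = ψ_n`, where `σ^*` is the conjugate transpose. No further condition relative to `Λ` is
imposed; the matrices whose blocks also satisfy the diagonal `Λ`-condition form a subgroup. -/
def GQ {R : Type*} [Ring R] [StarRing R] (n : ℕ) (lam : R) (_Λ : FormParameter lam) :
    Subgroup (Matrix (Fin n ⊕ Fin n) (Fin n ⊕ Fin n) R)ˣ where
  carrier := {σ | (σ : Matrix (Fin n ⊕ Fin n) (Fin n ⊕ Fin n) R).conjTranspose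
    * formMatrix lam n * (σ : Matrix (Fin n ⊕ Fin n) (Fin n ⊕ Fin n) R) = formMatrix lam n}
  one_mem' := by simp
  mul_mem' := by
    intro σ τ hσ hτ
    simp only [Set.mem_ofPred_eq, Units.val_mul, Matrix.conjTranspose_mul] at *
    calc _ = τ.val.conjTranspose * (σ.val.conjTranspose * formMatrix lam n * σ.val) * τ.val := by
          simp only [Matrix.mul_assoc]
      _ = _ := by rw [hσ, hτ]
  inv_mem' := by
    intro σ hσ
    simp only [Set.mem_ofPred_eq] at *
    have h : (σ⁻¹).val.conjTranspose * σ.val.conjTranspose = 1 := by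
      rw [← Matrix.conjTranspose_mul, Units.mul_inv, Matrix.conjTranspose_one]
    calc _ = (σ⁻¹).val.conjTranspose * (σ.val.conjTranspose * formMatrix lam n * σ.val)
            * (σ⁻¹).val := by rw [hσ]
      _ = ((σ⁻¹).val.conjTranspose * σ.val.conjTranspose) * formMatrix lam n
            * (σ.val * (σ⁻¹).val) := by simp only [Matrix.mul_assoc]
      _ = _ := by rw [h, Units.mul_inv, Matrix.one_mul, Matrix.mul_one]

/-- The elementary quadratic matrices. The diagonal ones `ql_ii(a)` are taken for `a ∈ Λ`, and
`qr_ii(a)` for `a` in the conjugate `Λ̄` of `Λ`, that is, `ā ∈ Λ`. -/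
inductive IsElementaryQuadratic {R : Type*} [Ring R] [StarRing R] {n : ℕ} {lam : R}
    (Λ : FormParameter lam) : Matrix (Fin n ⊕ Fin n) (Fin n ⊕ Fin n) R → Prop
  | qeps (i j : Fin n) (hij : i ≠ j) (a : R) : IsElementaryQuadratic Λ
      (1 + Matrix.single (Sum.inl i) (Sum.inl j) a
        - Matrix.single (Sum.inr j) (Sum.inr i) (star a))
  | qr (i j : Fin n) (hij : i ≠ j) (a : R) : IsElementaryQuadratic Λ
      (1 + Matrix.single (Sum.inl i) (Sum.inr j) a
        - Matrix.single (Sum.inl j) (Sum.inr i) (star lam * star a))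
  | ql (i j : Fin n) (hij : i ≠ j) (a : R) : IsElementaryQuadratic Λ
      (1 + Matrix.single (Sum.inr i) (Sum.inl j) a
        - Matrix.single (Sum.inr j) (Sum.inl i) (lam * star a))
  | qrDiag (i : Fin n) (a : R) (ha : star a ∈ Λ.toAddSubgroup) : IsElementaryQuadratic Λ
      (1 + Matrix.single (Sum.inl i) (Sum.inr i) a)
  | qlDiag (i : Fin n) (a : R) (ha : a ∈ Λ.toAddSubgroup) : IsElementaryQuadratic Λ
      (1 + Matrix.single (Sum.inr i) (Sum.inl i) a)

/-- The elementary quadratic group `EQ(2n, R, Λ)`, generated by the elementary quadratic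
matrices. -/
def EQ {R : Type*} [Ring R] [StarRing R] (n : ℕ) (lam : R) (Λ : FormParameter lam) :
    Subgroup (Matrix (Fin n ⊕ Fin n) (Fin n ⊕ Fin n) R)ˣ :=
  Subgroup.closure {σ | IsElementaryQuadratic Λ (σ : Matrix (Fin n ⊕ Fin n) (Fin n ⊕ Fin n) R)}

end FormRings

section LocalizedFormRings

/-- The involution of `R` restricted to the centre of `R`. -/
def starCenter {R : Type*} [Ring R] [StarRing R] (z : Subring.center R) : Subring.center R :=
  ⟨star (z : R), Set.star_mem_center z.2⟩

/-- A multiplicative set of central elements that is stable under the involution. -/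
class StarStable {R : Type*} [Ring R] [StarRing R] (S : Submonoid (Subring.center R)) : Prop where
  star_mem : ∀ z ∈ S, starCenter z ∈ S

/-- The involution on a star-stable multiplicative set of central elements. -/
def starDenom {R : Type*} [Ring R] [StarRing R] {S : Submonoid (Subring.center R)} [StarStable S]
    (s : S) : S :=
  ⟨starCenter s.1, StarStable.star_mem s.1 s.2⟩

theorem center_smul_def {R : Type*} [Ring R] {S : Submonoid (Subring.center R)} (s : S) (a : R) :
    s • a = (s.1 : R) * a := rfl

theorem center_comm {R : Type*} [Ring R] {S : Submonoid (Subring.center R)} (s : S) (a : R) :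
    a * (s.1 : R) = (s.1 : R) * a := Subring.mem_center_iff.mp s.1.2 a

theorem coe_starDenom {R : Type*} [Ring R] [StarRing R] {S : Submonoid (Subring.center R)}
    [StarStable S] (s : S) : ((starDenom s).1 : R) = star (s.1 : R) := rfl

theorem starDenom_mul {R : Type*} [Ring R] [StarRing R] {S : Submonoid (Subring.center R)}
    [StarStable S] (s t : S) : starDenom (s * t) = starDenom s * starDenom t := by
  apply Subtype.ext; apply Subtype.ext
  change star ((s.1 : R) * (t.1 : R)) = star (s.1 : R) * star (t.1 : R)
  rw [star_mul, ← coe_starDenom s, center_comm]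

theorem starDenom_starDenom {R : Type*} [Ring R] [StarRing R] {S : Submonoid (Subring.center R)}
    [StarStable S] (s : S) : starDenom (starDenom s) = s := by
  apply Subtype.ext; apply Subtype.ext
  exact star_star (s.1 : R)

theorem star_center_smul {R : Type*} [Ring R] [StarRing R] {S : Submonoid (Subring.center R)}
    [StarStable S] (s : S) (a : R) : star (s • a) = starDenom s • star a := by
  rw [center_smul_def, center_smul_def, star_mul, coe_starDenom, ← coe_starDenom, center_comm]

/-- The involution `a / s ↦ ā / s̄` on the localization `S⁻¹R`. -/
def starLoc {R : Type*} [Ring R] [StarRing R] (S : Submonoid (Subring.center R)) [StarStable S]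
    (x : LocalizedModule S R) : LocalizedModule S R :=
  LocalizedModule.liftOn x (fun p => LocalizedModule.mk (star p.1) (starDenom p.2)) (by
    rintro ⟨a, s⟩ ⟨b, t⟩ h
    obtain ⟨u, hu⟩ := h
    refine LocalizedModule.mk_eq.mpr ⟨starDenom u, ?_⟩
    have := congrArg star hu
    simpa only [star_center_smul] using this)

theorem starLoc_mk {R : Type*} [Ring R] [StarRing R] {S : Submonoid (Subring.center R)}
    [StarStable S] (a : R) (s : S) :
    starLoc S (LocalizedModule.mk a s) = LocalizedModule.mk (star a) (starDenom s) :=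
  LocalizedModule.liftOn_mk _ _ _

instance instStarRingLoc {R : Type*} [Ring R] [StarRing R] (S : Submonoid (Subring.center R))
    [StarStable S] : StarRing (LocalizedModule S R) where
  star := starLoc S
  star_involutive := by
    intro x
    induction x using LocalizedModule.induction_on with
    | _ a s => rw [starLoc_mk, starLoc_mk, star_star, starDenom_starDenom]
  star_mul := by
    intro x y
    induction x using LocalizedModule.induction_on with
    | _ a s =>
      induction y using LocalizedModule.induction_on with
      | _ b t =>
        change starLoc S _ = starLoc S _ * starLoc S _
        rw [LocalizedModule.mk_mul_mk, starLoc_mk, starLoc_mk, starLoc_mk,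
          LocalizedModule.mk_mul_mk, star_mul, mul_comm s t, starDenom_mul]
  star_add := by
    intro x y
    induction x using LocalizedModule.induction_on with
    | _ a s =>
      induction y using LocalizedModule.induction_on with
      | _ b t =>
        change starLoc S _ = starLoc S _ + starLoc S _
        rw [LocalizedModule.mk_add_mk, starLoc_mk, starLoc_mk, starLoc_mk,
          LocalizedModule.mk_add_mk, star_add, star_center_smul, star_center_smul, starDenom_mul]

theorem star_loc_mk {R : Type*} [Ring R] [StarRing R] {S : Submonoid (Subring.center R)}
    [StarStable S] (a : R) (s : S) :
    star (LocalizedModule.mk a s) = LocalizedModule.mk (star a) (starDenom s) :=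
  starLoc_mk a s

/-- The localization homomorphism `R → S⁻¹R`, `a ↦ a / 1`. -/
def toLoc {R : Type*} [Ring R] (S : Submonoid (Subring.center R)) : R →+* LocalizedModule S R :=
  LocalizedModule.numeratorRingHom

theorem toLoc_apply {R : Type*} [Ring R] {S : Submonoid (Subring.center R)} (a : R) :
    toLoc S a = LocalizedModule.mk a 1 := rfl

/-- The localized form parameter `{a / (s̄ s) : a ∈ Λ, s ∈ S}` on `S⁻¹R`. It is the smallest form
parameter containing the image of `Λ`: denominators are norms `s̄ s`, because a form parameter is
closed under `a ↦ x̄ a x` but in general not under multiplication by central elements. -/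
def FormParameter.loc {R : Type*} [Ring R] [StarRing R] {lam : R} (Λ : FormParameter lam)
    (S : Submonoid (Subring.center R)) [StarStable S] : FormParameter (toLoc S lam) where
  carrier := {x | ∃ a ∈ Λ.toAddSubgroup, ∃ s : S, x = LocalizedModule.mk a (starDenom s * s)}
  zero_mem' := ⟨0, Λ.zero_mem, 1, by rw [LocalizedModule.zero_mk]⟩
  add_mem' := by
    rintro _ _ ⟨a, ha, s, rfl⟩ ⟨b, hb, t, rfl⟩
    refine ⟨star (t.1 : R) * a * t.1 + star (s.1 : R) * b * s.1,
      Λ.add_mem (Λ.conj_mem _ _ ha) (Λ.conj_mem _ _ hb), s * t, ?_⟩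
    rw [LocalizedModule.mk_add_mk, starDenom_mul]
    congr 1
    · simp only [mul_smul, center_smul_def, center_comm, ← coe_starDenom]
      rw [← mul_assoc, ← mul_assoc, ← mul_assoc, ← mul_assoc, center_comm s, center_comm t]
    · exact mul_mul_mul_comm _ _ _ _
  neg_mem' := by
    rintro _ ⟨a, ha, s, rfl⟩
    exact ⟨-a, Λ.neg_mem ha, s, LocalizedModule.mk_neg.symm⟩
  min_le := by
    intro x
    induction x using LocalizedModule.induction_on with
    | _ a s =>
      refine ⟨(starDenom s • a) - lam * star (starDenom s • a), Λ.min_le _, s, ?_⟩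
      rw [star_loc_mk, star_center_smul, starDenom_starDenom]
      rw [toLoc_apply, LocalizedModule.mk_mul_mk, sub_eq_add_neg, ← LocalizedModule.mk_neg,
        LocalizedModule.mk_add_mk, one_mul, mul_comm s, sub_eq_add_neg, smul_neg]
      congr 3
      simp only [center_smul_def, ← mul_assoc, center_comm]
  le_max := by
    rintro _ ⟨a, ha, s, rfl⟩
    rw [star_loc_mk, starDenom_mul, starDenom_starDenom]
    rw [toLoc_apply, LocalizedModule.mk_mul_mk, one_mul, ← LocalizedModule.mk_neg, mul_comm s,
      ← Λ.le_max a ha]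
  conj_mem := by
    intro x y hy
    obtain ⟨a, ha, s, rfl⟩ := hy
    induction x using LocalizedModule.induction_on with
    | _ r t =>
      refine ⟨star r * a * r, Λ.conj_mem _ _ ha, s * t, ?_⟩
      rw [star_loc_mk, LocalizedModule.mk_mul_mk, LocalizedModule.mk_mul_mk, starDenom_mul]
      congr 1
      rw [mul_mul_mul_comm, ← mul_assoc, ← mul_assoc, mul_right_comm]
      ac_rfl

/-- The image over `S⁻¹R` of an invertible matrix over `R`. -/
def locMatrix {R : Type*} [Ring R] (S : Submonoid (Subring.center R)) {ι : Type*} [Fintype ι]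
    [DecidableEq ι] : (Matrix ι ι R)ˣ →* (Matrix ι ι (LocalizedModule S R))ˣ :=
  Units.map ((toLoc S).mapMatrix : Matrix ι ι R →+* Matrix ι ι (LocalizedModule S R)).toMonoidHom

end LocalizedFormRings

section GradedFormRings

/-- `(R, lam, Λ)` is a graded form ring for the grading `R = R₀ ⊕ R₁ ⊕ ⋯`: the element `lam` is
central of degree zero with `lam * lam̄ = 1`, the involution preserves degrees, and the homogeneous
components of an element of `Λ` lie in `Λ`. -/
structure IsGradedFormRing {R : Type*} [Ring R] [StarRing R] (𝒜 : ℕ → AddSubgroup R) [GradedRing 𝒜]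
    {lam : R} (Λ : FormParameter lam) : Prop where
  lam_center : lam ∈ Subring.center R
  lam_norm : lam * star lam = 1
  lam_deg : lam ∈ 𝒜 0
  star_deg : ∀ i, ∀ a ∈ 𝒜 i, star a ∈ 𝒜 i
  proj_mem : ∀ a ∈ Λ.toAddSubgroup, ∀ i, GradedRing.proj 𝒜 i a ∈ Λ.toAddSubgroup

/-- `x` is an element of `C(R₀)` outside the maximal ideal `m` of `C(R₀)`. -/
def OutsideMax {R : Type*} [Ring R] (𝒜 : ℕ → AddSubgroup R) [GradedRing 𝒜]
    (m : MaximalSpectrum (Subring.center (𝒜 0))) (x : R) : Prop :=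
  ∃ c : Subring.center (𝒜 0), ((c : 𝒜 0) : R) = x ∧ c ∉ m.asIdeal

/-- The denominators for localization at a maximal ideal `m` of `C(R₀)`: the elements `s ∈ C(R₀)`
(central in `R`) such that `s ∉ m` and `s̄ ∉ m`. If `m` is stable under the involution, these are
the elements of `C(R₀) ∖ m`; in general they form the largest subset of `C(R₀) ∖ m` that is stable
under the involution, so that the localization inherits the involution. -/
def maxDenoms {R : Type*} [Ring R] [StarRing R] (𝒜 : ℕ → AddSubgroup R) [GradedRing 𝒜]
    (m : MaximalSpectrum (Subring.center (𝒜 0))) : Submonoid (Subring.center R) where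
  carrier := {z | OutsideMax 𝒜 m (z : R) ∧ OutsideMax 𝒜 m (star (z : R))}
  one_mem' := by
    have h : OutsideMax 𝒜 m (1 : R) :=
      ⟨1, rfl, fun h => m.isMaximal.ne_top ((Ideal.eq_top_iff_one _).mpr h)⟩
    exact ⟨h, by simpa using h⟩
  mul_mem' := by
    have key : ∀ x y : R, OutsideMax 𝒜 m x → OutsideMax 𝒜 m y → OutsideMax 𝒜 m (x * y) := by
      rintro _ _ ⟨c, rfl, hc⟩ ⟨d, rfl, hd⟩
      exact ⟨c * d, rfl, fun h => (m.isMaximal.isPrime.mem_or_mem h).elim hc hd⟩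
    rintro z w ⟨hz, hz'⟩ ⟨hw, hw'⟩
    refine ⟨key _ _ hz hw, ?_⟩
    change OutsideMax 𝒜 m (star ((z : R) * (w : R)))
    rw [star_mul]
    exact key _ _ hw' hz'

instance instStarStableMaxDenoms {R : Type*} [Ring R] [StarRing R] (𝒜 : ℕ → AddSubgroup R)
    [GradedRing 𝒜] (m : MaximalSpectrum (Subring.center (𝒜 0))) : StarStable (maxDenoms 𝒜 m) where
  star_mem := by
    rintro z ⟨hz, hz'⟩
    refine ⟨hz', ?_⟩
    change OutsideMax 𝒜 m (star (star (z : R)))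
    rwa [star_star]

end GradedFormRings

/-! The proof is Quillen patching with respect to the grading parameter. Multiplying degree `i`
components by `X ^ i` turns `α` into a matrix α(X) over `R[X]` with α(1) = α and, since α ≡ 1 modulo
positive degrees, α(0) = 1. Let `I` be the set of scalars t such that α(x + ty)α(x)⁻¹ is elementary
for all scalars x, y. Telescoping shows that `I` is an ideal; if it contains 1, then x = 0, y = 1
gives the claim.

To evaluate at c inside the category of form rings, c must be central, fixed by the involution and
preserve Λ. Elements of C(R₀) need satisfy neither of the last two conditions, so `I` lives in the
subring of C(R₀) formed by such scalars. Traces c + c̄ and norms c̄c lie in this subring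
(`IsFormScalar.of_center`), so every c in C(R₀) is a root of a monic quadratic over it; the
extension is integral, and every maximal ideal of the subring lies under a maximal ideal m of C(R₀).
It is therefore enough to find, for each m, an element of `I` outside m.

This is the dilation principle `exists_scale_mem_EQ`, applied to γ(Y) = α(X + Y)α(X)⁻¹ over `R[X]`.
It is trivial at Y = 0 and elementary over the localization, hence γ(tY) is elementary over
`R[X][Y]` for some denominator t. Behind it stands `exists_conj_mem`: conjugation by an elementary
matrix over the localization carries root elements with sufficiently divisible coefficients into the
group generated by integral root elements. The commutator formulas give this directly except for
opposite roots, where the root element is first written through other roots; this is where n ≥ 3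
enters. -/

open Polynomial

/-! ### Scalars and morphisms of form rings -/

section FormScalars

/-- A central element `lam` with `lam * star lam = 1`. -/
class IsCentralUnitary {R : Type*} [Ring R] [StarRing R] (lam : R) : Prop where
  comm : ∀ a, lam * a = a * lam
  mul_star : lam * star lam = 1

/-- A scalar of a form ring: a central element, fixed by the involution, whose multiplication
preserves the form parameter. -/
structure IsFormScalar {R : Type*} [Ring R] [StarRing R] {lam : R} (Λ : FormParameter lam)
    (c : R) : Prop where
  comm : ∀ a, c * a = a * c
  star_eq : star c = c
  mul_mem : ∀ a ∈ Λ.toAddSubgroup, c * a ∈ Λ.toAddSubgroup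

/-- A morphism of form rings. -/
structure IsFormHom {R R' : Type*} [Ring R] [StarRing R] [Ring R'] [StarRing R'] {lam : R}
    {lam' : R'} (Λ : FormParameter lam) (Λ' : FormParameter lam') (f : R →+* R') : Prop where
  map_star : ∀ a, f (star a) = star (f a)
  map_lam : f lam = lam'
  map_mem : ∀ a ∈ Λ.toAddSubgroup, f a ∈ Λ'.toAddSubgroup

variable {R R' R'' : Type*} [Ring R] [StarRing R] [Ring R'] [StarRing R'] [Ring R''] [StarRing R'']
  {lam : R} {lam' : R'} {lam'' : R''} {Λ : FormParameter lam} {Λ' : FormParameter lam'}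
  {Λ'' : FormParameter lam''}

theorem FormParameter.eq_neg (Λ : FormParameter lam) {a : R} (ha : a ∈ Λ.toAddSubgroup) :
    a = -(lam * star a) := Λ.le_max a ha

theorem FormParameter.sub_mem_min (Λ : FormParameter lam) (a : R) :
    a - lam * star a ∈ Λ.toAddSubgroup := Λ.min_le a

theorem FormParameter.star_mul_mul_mem (Λ : FormParameter lam) (x : R) {a : R}
    (ha : a ∈ Λ.toAddSubgroup) : star x * a * x ∈ Λ.toAddSubgroup := Λ.conj_mem x a ha

theorem IsFormScalar.zero : IsFormScalar Λ 0 :=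
  ⟨by simp, by simp, fun a _ => by rw [zero_mul]; exact Λ.zero_mem⟩

theorem IsFormScalar.one : IsFormScalar Λ 1 := ⟨by simp, by simp, fun a ha => by simpa using ha⟩

theorem IsFormScalar.add {c d : R} (hc : IsFormScalar Λ c) (hd : IsFormScalar Λ d) :
    IsFormScalar Λ (c + d) :=
  ⟨fun a => by rw [add_mul, mul_add, hc.comm, hd.comm], by rw [star_add, hc.star_eq, hd.star_eq],
    fun a ha => by rw [add_mul]; exact Λ.add_mem (hc.mul_mem a ha) (hd.mul_mem a ha)⟩

theorem IsFormScalar.neg {c : R} (hc : IsFormScalar Λ c) : IsFormScalar Λ (-c) :=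
  ⟨fun a => by rw [neg_mul, mul_neg, hc.comm], by rw [star_neg, hc.star_eq],
    fun a ha => by rw [neg_mul]; exact Λ.neg_mem (hc.mul_mem a ha)⟩

theorem IsFormScalar.mul {c d : R} (hc : IsFormScalar Λ c) (hd : IsFormScalar Λ d) :
    IsFormScalar Λ (c * d) :=
  ⟨fun a => by rw [mul_assoc, hd.comm, ← mul_assoc, hc.comm, mul_assoc],
    by rw [star_mul, hc.star_eq, hd.star_eq, hc.comm],
    fun a ha => by rw [mul_assoc]; exact hc.mul_mem _ (hd.mul_mem a ha)⟩

theorem IsFormScalar.pow {c : R} (hc : IsFormScalar Λ c) (k : ℕ) : IsFormScalar Λ (c ^ k) := by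
  induction k with
  | zero => rw [pow_zero]; exact .one
  | succ k ih => rw [pow_succ]; exact ih.mul hc

theorem IsFormScalar.left_comm {c : R} (hc : IsFormScalar Λ c) (a b : R) :
    a * (c * b) = c * (a * b) := by
  rw [← mul_assoc, ← hc.comm, mul_assoc]

theorem IsFormHom.comp {g : R' →+* R''} {f : R →+* R'} (hg : IsFormHom Λ' Λ'' g)
    (hf : IsFormHom Λ Λ' f) : IsFormHom Λ Λ'' (g.comp f) where
  map_star a := by simp [hf.map_star, hg.map_star]
  map_lam := by simp [hf.map_lam, hg.map_lam]
  map_mem a ha := hg.map_mem _ (hf.map_mem _ ha)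

theorem IsFormHom.id : IsFormHom Λ Λ (RingHom.id R) := ⟨fun _ => rfl, rfl, fun _ h => h⟩

/-- The map on invertible matrices induced by a ring homomorphism. -/
abbrev glMap {R R' : Type*} [Ring R] [Ring R'] (ι : Type*) [Fintype ι] [DecidableEq ι]
    (f : R →+* R') : (Matrix ι ι R)ˣ →* (Matrix ι ι R')ˣ :=
  Units.map (f.mapMatrix : Matrix ι ι R →+* Matrix ι ι R').toMonoidHom

theorem glMap_apply {R R' : Type*} [Ring R] [Ring R'] {ι : Type*} [Fintype ι] [DecidableEq ι]
    (f : R →+* R') (σ : (Matrix ι ι R)ˣ) (i j : ι) :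
    (glMap ι f σ : Matrix ι ι R') i j = f ((σ : Matrix ι ι R) i j) := rfl

theorem glMap_glMap {R R' R'' : Type*} [Ring R] [Ring R'] [Ring R''] {ι : Type*} [Fintype ι]
    [DecidableEq ι] (g : R' →+* R'') (f : R →+* R') (σ : (Matrix ι ι R)ˣ) :
    glMap ι g (glMap ι f σ) = glMap ι (g.comp f) σ := by
  ext i j; rfl

theorem mapMatrix_single {R R' : Type*} [Ring R] [Ring R'] {ι : Type*} [Fintype ι] [DecidableEq ι]
    (f : R →+* R') (i j : ι) (a : R) :
    f.mapMatrix (Matrix.single i j a) = Matrix.single i j (f a) := by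
  simp [RingHom.mapMatrix_apply]

theorem IsElementaryQuadratic.map {n : ℕ} {f : R →+* R'} (hf : IsFormHom Λ Λ' f)
    {M : Matrix (Fin n ⊕ Fin n) (Fin n ⊕ Fin n) R} (hM : IsElementaryQuadratic Λ M) :
    IsElementaryQuadratic Λ' (f.mapMatrix M) := by
  cases hM with
  | qeps i j hij a =>
    simp only [map_add, map_sub, map_one, mapMatrix_single, hf.map_star]; exact .qeps i j hij _
  | qr i j hij a =>
    simp only [map_add, map_sub, map_one, mapMatrix_single, hf.map_star, map_mul, hf.map_lam]
    exact .qr i j hij _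
  | ql i j hij a =>
    simp only [map_add, map_sub, map_one, mapMatrix_single, hf.map_star, map_mul, hf.map_lam]
    exact .ql i j hij _
  | qrDiag i a ha =>
    simp only [map_add, map_one, mapMatrix_single]
    exact .qrDiag i _ (hf.map_star a ▸ hf.map_mem _ ha)
  | qlDiag i a ha =>
    simp only [map_add, map_one, mapMatrix_single]; exact .qlDiag i _ (hf.map_mem _ ha)

theorem IsFormHom.map_mem_EQ {n : ℕ} {f : R →+* R'} (hf : IsFormHom Λ Λ' f)
    {σ : (Matrix (Fin n ⊕ Fin n) (Fin n ⊕ Fin n) R)ˣ} (hσ : σ ∈ EQ n lam Λ) :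
    glMap _ f σ ∈ EQ n lam' Λ' := by
  have h : EQ n lam Λ ≤ (EQ n lam' Λ').comap (glMap _ f) :=
    (Subgroup.closure_le _).mpr fun τ hτ => Subgroup.subset_closure (hτ.map hf)
  exact h hσ

end FormScalars

/-! ### Evaluation of polynomials at scalars -/

section EvalHom

variable {R R' : Type*} [Ring R] [Ring R'] [StarRing R'] {lam' : R'} {Λ' : FormParameter lam'}

/-- Evaluation of polynomials at a scalar, along a ring homomorphism on the coefficients. -/
noncomputable def evalHom (f : R →+* R') {c : R'} (hc : IsFormScalar Λ' c) : R[X] →+* R' :=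
  eval₂RingHom' f c fun a => (hc.comm (f a)).symm

theorem evalHom_apply (f : R →+* R') {c : R'} (hc : IsFormScalar Λ' c) (p : R[X]) :
    evalHom f hc p = p.eval₂ f c := rfl

@[simp] theorem evalHom_C (f : R →+* R') {c : R'} (hc : IsFormScalar Λ' c) (a : R) :
    evalHom f hc (C a) = f a := eval₂_C ..

@[simp] theorem evalHom_X (f : R →+* R') {c : R'} (hc : IsFormScalar Λ' c) :
    evalHom f hc X = c := eval₂_X ..

end EvalHom

/-! ### Polynomial form rings -/

section PolynomialFormRings

namespace Polynomial

variable {R : Type*} [Ring R] [StarRing R]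

/-- The coefficientwise involution on polynomials, fixing the variable. -/
noncomputable instance instStarPolynomial : Star R[X] where
  star p := ∑ k ∈ p.support, monomial k (star (p.coeff k))

theorem coeff_star (p : R[X]) (k : ℕ) : (star p).coeff k = star (p.coeff k) := by
  change (∑ k ∈ p.support, monomial k (star (p.coeff k))).coeff k = _
  simp only [finsetSum_coeff, coeff_monomial, Finset.sum_ite_eq', mem_support_iff]
  split_ifs with h
  · rfl
  · rw [notMem_support_iff.mp h, star_zero]

noncomputable instance instStarRingPolynomial : StarRing R[X] where
  star_involutive p := by ext k; simp [coeff_star]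
  star_mul p q := by
    ext k
    rw [coeff_star, coeff_mul, coeff_mul, star_sum, ← Finset.Nat.sum_antidiagonal_swap]
    simp [coeff_star]
  star_add p q := by ext k; simp [coeff_star]

@[simp] theorem star_C (a : R) : star (C a) = C (star a) := by
  ext k; rw [coeff_star, coeff_C, coeff_C]; split_ifs <;> simp

@[simp] theorem star_monomial (k : ℕ) (a : R) :
    star (monomial k a) = monomial k (star a) := by
  ext l; rw [coeff_star, coeff_monomial, coeff_monomial]; split_ifs <;> simp

@[simp] theorem star_X : star (X : R[X]) = X := by
  rw [← monomial_one_one_eq_X, star_monomial, star_one]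

end Polynomial

variable {R R' : Type*} [Ring R] [StarRing R] [Ring R'] [StarRing R'] {lam : R} {lam' : R'}

instance instIsCentralUnitaryC [h : IsCentralUnitary lam] : IsCentralUnitary (C lam : R[X]) where
  comm p := by ext k; rw [coeff_C_mul, coeff_mul_C, h.comm]
  mul_star := by rw [star_C, ← C_mul, h.mul_star, C_1]

/-- The form parameter on `R[X]` of all polynomials with coefficients in `Λ`. -/
noncomputable def FormParameter.polynomial [IsCentralUnitary lam] (Λ : FormParameter lam) :
    FormParameter (C lam : R[X]) where
  carrier := {p | ∀ k, p.coeff k ∈ Λ.toAddSubgroup}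
  zero_mem' k := by rw [coeff_zero]; exact Λ.zero_mem
  add_mem' hp hq k := by rw [coeff_add]; exact Λ.add_mem (hp k) (hq k)
  neg_mem' hp k := by rw [coeff_neg]; exact Λ.neg_mem (hp k)
  min_le p k := by rw [coeff_sub, coeff_C_mul, coeff_star]; exact Λ.sub_mem_min _
  le_max p hp := by ext k; rw [coeff_neg, coeff_C_mul, coeff_star]; exact Λ.eq_neg (hp k)
  conj_mem x p hp := by
    induction x using Polynomial.induction_on' with
    | add x y hx hy =>
      intro k
      have hpe : p = -(C lam * star p) := by
        ext k; rw [coeff_neg, coeff_C_mul, coeff_star]; exact Λ.eq_neg (hp k)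
      -- Since p = -λp̄, the cross terms x̄py + ȳpx have the form b - λb̄ with b = x̄py, so they lie
      -- in the minimal form parameter. This makes the condition additive in the conjugating
      -- polynomial and leaves only monomials.
      have h : C lam * star (star x * p * y) = -(star y * p * x) := by
        rw [star_mul, star_mul, star_star, ← mul_assoc, IsCentralUnitary.comm (lam := C lam) (star y),
          mul_assoc (star y), ← mul_assoc (C lam), ← neg_eq_iff_eq_neg.mpr hpe]
        noncomm_ring
      have e : star (x + y) * p * (x + y) = star x * p * x + star y * p * y
          + (star x * p * y - C lam * star (star x * p * y)) := by
        rw [h, star_add]; noncomm_ring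
      rw [e, coeff_add, coeff_add]
      refine Λ.add_mem (Λ.add_mem (hx k) (hy k)) ?_
      rw [coeff_sub, coeff_C_mul, coeff_star]; exact Λ.sub_mem_min _
    | monomial i r =>
      intro k
      rw [star_monomial, ← C_mul_X_pow_eq_monomial, ← C_mul_X_pow_eq_monomial,
        ← mul_assoc, coeff_mul_X_pow', mul_assoc (C (star r)), X_pow_mul, ← mul_assoc,
        mul_assoc _ (X ^ i), X_pow_mul_C, ← mul_assoc]
      split_ifs with h
      · rw [coeff_mul_X_pow']
        split_ifs with h'
        · rw [coeff_mul_C, coeff_C_mul]; exact Λ.star_mul_mul_mem _ (hp _)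
        · exact Λ.zero_mem
      · exact Λ.zero_mem

variable [IsCentralUnitary lam] {Λ : FormParameter lam}
  {Λ' : FormParameter lam'}

theorem FormParameter.mem_polynomial {p : R[X]} :
    p ∈ Λ.polynomial.toAddSubgroup ↔ ∀ k, p.coeff k ∈ Λ.toAddSubgroup := Iff.rfl

theorem IsFormScalar.X : IsFormScalar Λ.polynomial (X : R[X]) where
  comm p := X_mul
  star_eq := star_X
  mul_mem p hp k := by
    cases k with
    | zero => rw [coeff_X_mul_zero]; exact Λ.zero_mem
    | succ k => rw [coeff_X_mul]; exact hp k

theorem IsFormScalar.C {c : R} (hc : IsFormScalar Λ c) : IsFormScalar Λ.polynomial (C c) where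
  comm p := by ext k; rw [coeff_C_mul, coeff_mul_C, hc.comm]
  star_eq := by rw [star_C, hc.star_eq]
  mul_mem p hp k := by rw [coeff_C_mul]; exact hc.mul_mem _ (hp k)

theorem IsFormHom.C : IsFormHom Λ Λ.polynomial (C : R →+* R[X]) where
  map_star a := (star_C a).symm
  map_lam := rfl
  map_mem a ha k := by rw [coeff_C]; split_ifs; exacts [ha, Λ.zero_mem]

theorem IsFormHom.evalHom {f : R →+* R'} (hf : IsFormHom Λ Λ' f) {c : R'}
    (hc : IsFormScalar Λ' c) : IsFormHom Λ.polynomial Λ' (evalHom f hc) where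
  map_star p := by
    induction p using Polynomial.induction_on' with
    | add p q hp hq => rw [star_add, map_add, map_add, star_add, hp, hq]
    | monomial k a =>
      rw [star_monomial, evalHom_apply, evalHom_apply, eval₂_monomial, eval₂_monomial, star_mul,
        hf.map_star, (hc.pow k).star_eq, (hc.pow k).comm]
  map_lam := by rw [evalHom_C, hf.map_lam]
  map_mem p hp := by
    rw [evalHom_apply, eval₂_eq_sum, sum_def]
    refine sum_mem fun k _ => ?_
    rw [← (hc.pow k).comm]
    exact (hc.pow k).mul_mem _ (hf.map_mem _ (hp k))

variable [IsCentralUnitary lam']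

theorem IsFormHom.polynomial {f : R →+* R'} (hf : IsFormHom Λ Λ' f) :
    IsFormHom Λ.polynomial Λ'.polynomial (mapRingHom f) where
  map_star p := by ext k; simp [coeff_star, hf.map_star]
  map_lam := by simp [hf.map_lam]
  map_mem p hp k := by simpa using hf.map_mem _ (hp k)

theorem polynomial_ringHom_ext {R B : Type*} [Ring R] [Ring B] {f g : R[X] →+* B}
    (hC : ∀ a, f (C a) = g (C a)) (hX : f X = g X) : f = g :=
  Polynomial.ringHom_ext hC hX

end PolynomialFormRings

/-! ### Long root elements -/

section LongRoots

variable {R : Type*} [Ring R] {n : ℕ} {i h : Fin n ⊕ Fin n}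

/-- The product of two matrix units, as a conditional. -/
theorem single_mul_single_ite {ι R : Type*} [Fintype ι] [DecidableEq ι] [Ring R] (i j k l : ι)
    (a b : R) : Matrix.single i j a * Matrix.single k l b
      = if j = k then Matrix.single i l (a * b) else 0 := by
  split_ifs with h
  · subst h; rw [Matrix.single_mul_single_same]
  · rw [Matrix.single_mul_single_of_ne _ _ _ _ h]

theorem single_sub_entry {ι R : Type*} [DecidableEq ι] [Ring R] (i j : ι) (a b : R) :
    Matrix.single i j (a - b) = Matrix.single i j a - Matrix.single i j b := by
  rw [sub_eq_add_neg, Matrix.single_add, ← Matrix.single_neg, sub_eq_add_neg]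

theorem swap_ne {α : Type*} {i j : α ⊕ α} : i.swap ≠ j ↔ i ≠ j.swap := by
  rw [not_iff_not]; constructor <;> rintro rfl <;> simp

theorem swap_ne_self {α : Type*} (i : α ⊕ α) : i.swap ≠ i := by
  rcases i with i | i <;> simp

theorem self_ne_swap {α : Type*} (i : α ⊕ α) : i ≠ i.swap := (swap_ne_self i).symm

theorem swap_inj {α : Type*} {i j : α ⊕ α} : i.swap = j.swap ↔ i = j :=
  ⟨fun h => by rw [← Sum.swap_swap i, h, Sum.swap_swap], congrArg _⟩

/-- The long root element at `(i, ρ i)`. -/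
def longRoot (i : Fin n ⊕ Fin n) (a : R) : (Matrix (Fin n ⊕ Fin n) (Fin n ⊕ Fin n) R)ˣ where
  val := 1 + Matrix.single i i.swap a
  inv := 1 + Matrix.single i i.swap (-a)
  val_inv := by
    simp [mul_add, add_mul, swap_ne_self, ← Matrix.single_add, add_assoc]
  inv_val := by
    simp [mul_add, add_mul, swap_ne_self, ← Matrix.single_add, add_assoc]

theorem longRoot_inv (i : Fin n ⊕ Fin n) (a : R) : (longRoot i a)⁻¹ = longRoot i (-a) :=
  Units.ext rfl

theorem longRoot_add (i : Fin n ⊕ Fin n) (a b : R) :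
    longRoot i (a + b) = longRoot i a * longRoot i b := by
  ext1
  simp [longRoot, mul_add, add_mul, swap_ne_self, Matrix.single_add, add_assoc]

theorem longRoot_comm (h₁ : h ≠ i.swap) (a b : R) : Commute (longRoot i a) (longRoot h b) := by
  ext1
  simp only [longRoot, Units.val_mul, mul_add, add_mul,
    single_mul_single_ite, h₁.symm, swap_ne.mpr h₁, if_false, one_mul, mul_one]
  abel

end LongRoots

/-! ### Short root elements and the commutator formulas -/

section RootElements

variable {R R' : Type*} [Ring R] [StarRing R] [Ring R'] [StarRing R'] {n : ℕ}

/-- The central unit attached to an index: `1` on the first half and `lam` on the second. -/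
def indexUnit (lam : R) (i : Fin n ⊕ Fin n) : R := Sum.elim (fun _ => 1) (fun _ => lam) i

/-- The entry at `(ρ j, ρ i)` of the adjoint, with respect to the form, of the matrix with the
single entry `a` at `(i, j)`. -/
def adjEntry (lam : R) (i j : Fin n ⊕ Fin n) (a : R) : R :=
  indexUnit lam i * star (indexUnit lam j) * star a

/-- The coefficients of the long root elements at `(i, ρ i)`. -/
def FormParameter.longCoeff {lam : R} (Λ : FormParameter lam) (i : Fin n ⊕ Fin n) :
    AddSubgroup R :=
  Λ.toAddSubgroup.comap (AddMonoidHom.mulLeft (indexUnit lam i.swap))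

theorem FormParameter.mem_longCoeff {lam : R} {Λ : FormParameter lam} {i : Fin n ⊕ Fin n} {a : R} :
    a ∈ Λ.longCoeff i ↔ indexUnit lam i.swap * a ∈ Λ.toAddSubgroup := Iff.rfl

variable {lam : R} {lam' : R'} {Λ : FormParameter lam} {Λ' : FormParameter lam'}

theorem adjEntry_add (i j : Fin n ⊕ Fin n) (a b : R) :
    adjEntry lam i j (a + b) = adjEntry lam i j a + adjEntry lam i j b := by
  simp [adjEntry, mul_add]

@[simp] theorem adjEntry_neg (i j : Fin n ⊕ Fin n) (a : R) :
    adjEntry lam i j (-a) = -adjEntry lam i j a := by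
  simp [adjEntry]

@[simp] theorem adjEntry_zero (i j : Fin n ⊕ Fin n) : adjEntry lam i j 0 = 0 := by
  simp [adjEntry]

theorem IsFormHom.map_indexUnit {f : R →+* R'} (hf : IsFormHom Λ Λ' f) (i : Fin n ⊕ Fin n) :
    f (indexUnit lam i) = indexUnit lam' i := by
  rcases i with i | i <;> simp [indexUnit, hf.map_lam]

theorem IsFormHom.map_adjEntry {f : R →+* R'} (hf : IsFormHom Λ Λ' f) (i j : Fin n ⊕ Fin n)
    (a : R) : f (adjEntry lam i j a) = adjEntry lam' i j (f a) := by
  simp [adjEntry, hf.map_star, hf.map_indexUnit]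

theorem IsFormHom.map_mem_longCoeff {f : R →+* R'} (hf : IsFormHom Λ Λ' f) {i : Fin n ⊕ Fin n}
    {a : R} (ha : a ∈ Λ.longCoeff i) : f a ∈ Λ'.longCoeff i := by
  have := hf.map_mem _ ha
  rwa [AddMonoidHom.coe_mulLeft, map_mul, hf.map_indexUnit] at this

theorem IsFormScalar.mul_mem_longCoeff {c : R} (hc : IsFormScalar Λ c) {i : Fin n ⊕ Fin n}
    {a : R} (ha : a ∈ Λ.longCoeff i) : c * a ∈ Λ.longCoeff i := by
  rw [FormParameter.mem_longCoeff, ← mul_assoc, ← hc.comm, mul_assoc]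
  exact hc.mul_mem _ ha

theorem IsFormScalar.adjEntry_mul {c : R} (hc : IsFormScalar Λ c) (i j : Fin n ⊕ Fin n) (a : R) :
    adjEntry lam i j (c * a) = c * adjEntry lam i j a := by
  rw [adjEntry, adjEntry, star_mul, hc.star_eq, ← mul_assoc, ← hc.comm]

variable {i j h k : Fin n ⊕ Fin n}

/-- The matrix of a short root element. -/
def shortMat (lam : R) (i j : Fin n ⊕ Fin n) (a : R) :
    Matrix (Fin n ⊕ Fin n) (Fin n ⊕ Fin n) R :=
  1 + Matrix.single i j a - Matrix.single j.swap i.swap (adjEntry lam i j a)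

theorem shortMat_mul {i j : Fin n ⊕ Fin n} (h : i ≠ j) (h' : i ≠ j.swap) (a b : R) :
    shortMat lam i j a * shortMat lam i j b = shortMat lam i j (a + b) := by
  have h'' : i.swap ≠ j := swap_ne.mpr h'
  simp only [shortMat, mul_add, add_mul, mul_sub, sub_mul, single_mul_single_ite, h.symm,
    swap_inj, self_ne_swap, swap_ne_self, h, if_false, adjEntry_add,
    Matrix.single_add, one_mul, mul_one]
  abel

/-- The short root element at `(i, j)`. -/
def shortRoot (lam : R) {i j : Fin n ⊕ Fin n} (h : i ≠ j) (h' : i ≠ j.swap) (a : R) :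
    (Matrix (Fin n ⊕ Fin n) (Fin n ⊕ Fin n) R)ˣ where
  val := shortMat lam i j a
  inv := shortMat lam i j (-a)
  val_inv := by rw [shortMat_mul h h', add_neg_cancel]; simp [shortMat]
  inv_val := by rw [shortMat_mul h h', neg_add_cancel]; simp [shortMat]

theorem shortRoot_add (h : i ≠ j) (h' : i ≠ j.swap) (a b : R) :
    shortRoot lam h h' (a + b) = shortRoot lam h h' a * shortRoot lam h h' b :=
  Units.ext (shortMat_mul h h' a b).symm

theorem shortRoot_inv (h : i ≠ j) (h' : i ≠ j.swap) (a : R) :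
    (shortRoot lam h h' a)⁻¹ = shortRoot lam h h' (-a) := Units.ext rfl

theorem shortRoot_comm (hij : i ≠ j) (hij' : i ≠ j.swap) (hhk : h ≠ k) (hhk' : h ≠ k.swap)
    (h₁ : h ≠ j) (h₂ : h ≠ i.swap) (h₃ : k ≠ i) (h₄ : k ≠ j.swap) (a b : R) :
    Commute (shortRoot lam hij hij' a) (shortRoot lam hhk hhk' b) := by
  have e : ∀ x y : Fin n ⊕ Fin n, x ≠ y.swap → x.swap ≠ y := fun _ _ => swap_ne.mpr
  ext1
  simp only [shortRoot, shortMat, Units.val_mul, mul_add, add_mul, mul_sub, sub_mul,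
    single_mul_single_ite, swap_inj, h₁, h₁.symm, h₂.symm, h₃,
    h₃.symm, h₄, e _ _ h₂, (e _ _ h₄).symm, if_false, one_mul, mul_one]
  abel

theorem shortRoot_longRoot_comm (hij : i ≠ j) (hij' : i ≠ j.swap) (h₁ : h ≠ j) (h₂ : h ≠ i.swap)
    (a b : R) : Commute (shortRoot lam hij hij' a) (longRoot h b) := by
  ext1
  simp only [shortRoot, shortMat, longRoot, Units.val_mul, mul_add, add_mul, mul_sub, sub_mul,
    single_mul_single_ite, swap_inj, h₁.symm, h₁, h₂.symm, swap_ne.mpr h₂, if_false, one_mul, mul_one]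
  abel

variable [IsCentralUnitary lam]

theorem star_lam_mul : star lam * lam = 1 := by
  rw [← IsCentralUnitary.comm (lam := lam), IsCentralUnitary.mul_star]

theorem star_lam_comm (a : R) : star lam * a = a * star lam := by
  have h := congrArg star (IsCentralUnitary.comm (lam := lam) (star a))
  simpa using h.symm

theorem indexUnit_comm (i : Fin n ⊕ Fin n) (a : R) :
    indexUnit lam i * a = a * indexUnit lam i := by
  rcases i with i | i <;> simp [indexUnit, IsCentralUnitary.comm (lam := lam) a]

theorem star_indexUnit_comm (i : Fin n ⊕ Fin n) (a : R) :
    star (indexUnit lam i) * a = a * star (indexUnit lam i) := by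
  rcases i with i | i <;> simp [indexUnit, star_lam_comm]

theorem star_indexUnit_mul (i : Fin n ⊕ Fin n) : star (indexUnit lam i) * indexUnit lam i = 1 := by
  rcases i with i | i <;> simp [indexUnit, star_lam_mul]

theorem indexUnit_mul_star (i : Fin n ⊕ Fin n) : indexUnit lam i * star (indexUnit lam i) = 1 := by
  rw [indexUnit_comm, star_indexUnit_mul]

theorem indexUnit_swap (i : Fin n ⊕ Fin n) :
    indexUnit lam i.swap = lam * star (indexUnit lam i) := by
  rcases i with i | i <;> simp [indexUnit, IsCentralUnitary.mul_star]

theorem indexUnit_left_comm (i : Fin n ⊕ Fin n) (a b : R) :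
    a * (indexUnit lam i * b) = indexUnit lam i * (a * b) := by
  rw [← mul_assoc, ← indexUnit_comm, mul_assoc]

theorem star_indexUnit_left_comm (i : Fin n ⊕ Fin n) (a b : R) :
    a * (star (indexUnit lam i) * b) = star (indexUnit lam i) * (a * b) := by
  rw [← mul_assoc, ← star_indexUnit_comm, mul_assoc]

theorem indexUnit_mul_star_mul (i : Fin n ⊕ Fin n) (a : R) :
    indexUnit lam i * (star (indexUnit lam i) * a) = a := by
  rw [← mul_assoc, indexUnit_mul_star, one_mul]

theorem star_indexUnit_mul_mul (i : Fin n ⊕ Fin n) (a : R) :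
    star (indexUnit lam i) * (indexUnit lam i * a) = a := by
  rw [← mul_assoc, star_indexUnit_mul, one_mul]

theorem lam_mul_star_mul (a : R) : lam * (star lam * a) = a := by
  rw [← mul_assoc, IsCentralUnitary.mul_star, one_mul]

theorem adjEntry_adjEntry (i j : Fin n ⊕ Fin n) (a : R) :
    adjEntry lam j.swap i.swap (adjEntry lam i j a) = a := by
  simp only [adjEntry, star_mul, star_star, indexUnit_swap, mul_assoc]
  rw [indexUnit_left_comm j a, ← star_indexUnit_comm i a, indexUnit_left_comm j (star lam),
    star_indexUnit_left_comm i (star lam), indexUnit_left_comm j (indexUnit lam i),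
    indexUnit_mul_star_mul, star_indexUnit_mul_mul, lam_mul_star_mul]

theorem adjEntry_mul (i j k : Fin n ⊕ Fin n) (a b : R) :
    adjEntry lam i k (a * b) = adjEntry lam j k b * adjEntry lam i j a := by
  simp only [adjEntry, star_mul, mul_assoc]
  rw [star_indexUnit_left_comm j, star_indexUnit_left_comm j, star_indexUnit_left_comm j,
    indexUnit_mul_star_mul, indexUnit_left_comm i, indexUnit_left_comm i]

theorem adjEntry_self_swap (i : Fin n ⊕ Fin n) (a : R) :
    indexUnit lam i.swap * adjEntry lam i i.swap a
      = lam * star (indexUnit lam i.swap * a) := by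
  rw [adjEntry, star_mul, mul_assoc, indexUnit_swap, star_mul, star_star, ← mul_assoc,
    mul_assoc lam, star_indexUnit_mul, mul_one, ← star_lam_comm (lam := lam),
    mul_assoc (star lam), indexUnit_comm, ← mul_assoc (star lam), star_lam_comm, mul_assoc]

theorem indexUnit_mul_left_cancel (i : Fin n ⊕ Fin n) (a b : R)
    (h : indexUnit lam i * a = indexUnit lam i * b) : a = b := by
  rw [← one_mul a, ← one_mul b, ← star_indexUnit_mul (lam := lam) i, mul_assoc, h, mul_assoc]

/-- This is Λ ⊆ Λ_max in root coordinates; it supplies the signs in the commutator formula of a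
short with a long root. -/
theorem adjEntry_of_mem_longCoeff {i : Fin n ⊕ Fin n} {a : R} (ha : a ∈ Λ.longCoeff i) :
    adjEntry lam i i.swap a = -a := by
  apply indexUnit_mul_left_cancel (lam := lam) i.swap
  rw [adjEntry_self_swap, mul_neg, eq_neg_iff_add_eq_zero, ← neg_eq_iff_add_eq_zero]
  exact (Λ.eq_neg ha).symm

/-- This is Λ_min ⊆ Λ in root coordinates: the long root element produced by two short ones has an
admissible coefficient. -/
theorem sub_adjEntry_mem_longCoeff (Λ : FormParameter lam) (i : Fin n ⊕ Fin n) (a : R) :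
    a - adjEntry lam i i.swap a ∈ Λ.longCoeff i := by
  rw [FormParameter.mem_longCoeff, mul_sub, adjEntry_self_swap]
  exact Λ.sub_mem_min _

/-- This is x̄Λx ⊆ Λ in root coordinates, with x = b̄. -/
theorem mul_mul_adjEntry_mem_longCoeff {i j : Fin n ⊕ Fin n} {a : R} (ha : a ∈ Λ.longCoeff j)
    (b : R) : b * a * adjEntry lam i j b ∈ Λ.longCoeff i := by
  have h := Λ.star_mul_mul_mem (star b) ha
  rw [star_star, AddMonoidHom.coe_mulLeft] at h
  rw [FormParameter.mem_longCoeff]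
  convert h using 1
  rw [adjEntry, indexUnit_swap, indexUnit_swap]
  simp only [mul_assoc]
  rw [indexUnit_left_comm i a, indexUnit_left_comm i b, star_indexUnit_mul_mul,
    star_indexUnit_left_comm j a, star_indexUnit_left_comm j b, ← mul_assoc b lam,
    ← IsCentralUnitary.comm (lam := lam) b, mul_assoc lam b, star_indexUnit_left_comm j b]

/-- A short root element has two nonzero off-diagonal positions, (i, j) and (ρj, ρi), either of
which may name it. Passing between the names halves the case distinctions below. -/
theorem shortRoot_flip (h : i ≠ j) (h' : i ≠ j.swap) (a : R) :
    shortRoot lam h h' a = shortRoot lam (i := j.swap) (j := i.swap) (fun e => h (swap_inj.mp e).symm)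
      (fun e => h' (by rw [e, Sum.swap_swap])) (-adjEntry lam i j a) := by
  ext1
  simp only [shortRoot, shortMat, adjEntry_neg, adjEntry_adjEntry, Sum.swap_swap, ← Matrix.single_neg]
  abel

theorem shortRoot_flip_of_eq {i' j' : Fin n ⊕ Fin n} (h : i ≠ j) (h' : i ≠ j.swap) (g : i' ≠ j')
    (g' : i' ≠ j'.swap) (e₁ : i' = j.swap) (e₂ : j' = i.swap) (a : R) :
    shortRoot lam h h' a = shortRoot lam g g' (-adjEntry lam i j a) := by
  subst e₁ e₂; exact shortRoot_flip h h' a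

/-- Here and in the next two formulas the commutator relation is written as a reordering of a
product, so that multiplying by an inverse on the right yields the conjugate at once. -/
theorem shortRoot_mul_shortRoot (hij : i ≠ j) (hij' : i ≠ j.swap) (hjk : j ≠ k) (hjk' : j ≠ k.swap)
    (hik : i ≠ k) (hik' : i ≠ k.swap) (a b : R) :
    shortRoot lam hij hij' a * shortRoot lam hjk hjk' b
      = shortRoot lam hik hik' (a * b) * shortRoot lam hjk hjk' b * shortRoot lam hij hij' a := by
  ext1
  simp only [shortRoot, shortMat, Units.val_mul, mul_add, add_mul, mul_sub, sub_mul,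
    single_mul_single_ite, swap_inj, self_ne_swap, swap_ne_self, hij, hij'.symm,
    swap_ne.mpr hij', hjk', hjk.symm,
    (swap_ne.mpr hjk').symm, hik, hik.symm,
    if_false, if_true, one_mul, mul_one, adjEntry_mul i j k, zero_mul]
  abel

theorem shortRoot_mul_shortRoot_swap (hij : i ≠ j) (hij' : i ≠ j.swap) (hji : j ≠ i.swap)
    (hji' : j ≠ i.swap.swap) (a b : R) :
    shortRoot lam hij hij' a * shortRoot lam hji hji' b
      = longRoot i (a * b - adjEntry lam i i.swap (a * b)) * shortRoot lam hji hji' b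
        * shortRoot lam hij hij' a := by
  ext1
  simp only [shortRoot, shortMat, longRoot, Units.val_mul, mul_add, add_mul, mul_sub, sub_mul,
    single_mul_single_ite, swap_inj, swap_ne_self, hij, hij.symm, hij'.symm,
    swap_ne.mpr hij', Sum.swap_swap,
    if_false, if_true, one_mul, mul_one, adjEntry_mul i j i.swap, zero_mul, single_sub_entry]
  abel

theorem shortRoot_mul_longRoot (hij : i ≠ j) (hij' : i ≠ j.swap) (hij'' : i ≠ j.swap.swap)
    (a : R) {b : R} (hb : b ∈ Λ.longCoeff j) :
    shortRoot lam hij hij' a * longRoot j b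
      = longRoot j b * longRoot i (a * b * adjEntry lam i j a)
        * shortRoot lam hij' hij'' (a * b) * shortRoot lam hij hij' a := by
  ext1
  simp only [shortRoot, shortMat, longRoot, Units.val_mul, mul_add, add_mul, mul_sub, sub_mul,
    single_mul_single_ite, swap_inj, swap_ne_self, hij, hij'.symm,
    swap_ne.mpr hij', Sum.swap_swap,
    if_false, if_true, one_mul, mul_one, adjEntry_mul i j j.swap, zero_mul,
    adjEntry_of_mem_longCoeff hb, neg_mul, sub_neg_eq_add, ← Matrix.single_neg]
  abel

end RootElements

/-! ### Root elements generate the elementary group -/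

section RootsGenerate

variable {R : Type*} [Ring R] [StarRing R] {n : ℕ} {lam : R} {Λ : FormParameter lam}
  [IsCentralUnitary lam]

theorem longRoot_mem_EQ {i : Fin n ⊕ Fin n} {a : R} (ha : a ∈ Λ.longCoeff i) :
    longRoot i a ∈ EQ n lam Λ := by
  refine Subgroup.subset_closure ?_
  rcases i with i | i
  · refine IsElementaryQuadratic.qrDiag i a ?_
    have h := adjEntry_of_mem_longCoeff ha
    simp only [adjEntry, indexUnit, Sum.swap_inl, Sum.elim_inl, Sum.elim_inr, one_mul] at h
    have h' : star a = -(lam * a) := by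
      rw [← mul_neg, ← h, lam_mul_star_mul]
    rw [h']
    exact Λ.neg_mem ha
  · refine IsElementaryQuadratic.qlDiag i a ?_
    simpa [FormParameter.mem_longCoeff, indexUnit] using ha

theorem shortRoot_inl_mem_EQ {i : Fin n} {j : Fin n ⊕ Fin n} (h : Sum.inl i ≠ j)
    (h' : Sum.inl i ≠ j.swap) (a : R) : shortRoot lam h h' a ∈ EQ n lam Λ := by
  refine Subgroup.subset_closure ?_
  rcases j with j | j
  · have := IsElementaryQuadratic.qeps (Λ := Λ) i j (by simpa using h) a
    simpa [shortRoot, shortMat, adjEntry, indexUnit] using this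
  · have := IsElementaryQuadratic.qr (Λ := Λ) i j (by simpa using h') a
    simpa [shortRoot, shortMat, adjEntry, indexUnit] using this

theorem shortRoot_mem_EQ {i j : Fin n ⊕ Fin n} (h : i ≠ j) (h' : i ≠ j.swap) (a : R) :
    shortRoot lam h h' a ∈ EQ n lam Λ := by
  rcases i with i | i
  · exact shortRoot_inl_mem_EQ h h' a
  · rcases j with j | j
    · refine Subgroup.subset_closure ?_
      have := IsElementaryQuadratic.ql (Λ := Λ) i j (by simpa using h') a
      simpa [shortRoot, shortMat, adjEntry, indexUnit] using this
    · rw [shortRoot_flip]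
      exact shortRoot_inl_mem_EQ _ _ _

theorem EQ_le_of_roots {H : Subgroup (Matrix (Fin n ⊕ Fin n) (Fin n ⊕ Fin n) R)ˣ}
    (hshort : ∀ (i j : Fin n ⊕ Fin n) (h : i ≠ j) (h' : i ≠ j.swap) (a : R),
      shortRoot lam h h' a ∈ H)
    (hlong : ∀ (i : Fin n ⊕ Fin n), ∀ a ∈ Λ.longCoeff i, longRoot i a ∈ H) :
    EQ n lam Λ ≤ H := by
  refine (Subgroup.closure_le _).mpr fun σ hσ => ?_
  obtain ⟨M, hM⟩ : ∃ M, M = (σ : Matrix (Fin n ⊕ Fin n) (Fin n ⊕ Fin n) R) := ⟨_, rfl⟩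
  change IsElementaryQuadratic Λ _ at hσ
  rw [← hM] at hσ
  cases hσ with
  | qeps i j hij a =>
    have e : σ = shortRoot lam (i := .inl i) (j := .inl j) (by simpa using hij) (by simp) a :=
      Units.ext (by simp [← hM, shortRoot, shortMat, adjEntry, indexUnit])
    exact e ▸ hshort ..
  | qr i j hij a =>
    have e : σ = shortRoot lam (i := .inl i) (j := .inr j) (by simp) (by simpa using hij) a :=
      Units.ext (by simp [← hM, shortRoot, shortMat, adjEntry, indexUnit])
    exact e ▸ hshort ..
  | ql i j hij a =>
    have e : σ = shortRoot lam (i := .inr i) (j := .inl j) (by simp) (by simpa using hij) a :=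
      Units.ext (by simp [← hM, shortRoot, shortMat, adjEntry, indexUnit])
    exact e ▸ hshort ..
  | qrDiag i a ha =>
    -- The generator is given with ā ∈ Λ, while `longCoeff` asks for λa ∈ Λ; these agree because -ā
    -- = λa on Λ_max.
    have h := Λ.neg_mem ha
    nth_rw 1 [Λ.eq_neg ha] at h
    rw [neg_neg, star_star] at h
    have e : σ = longRoot (.inl i) a := Units.ext (by simp [← hM, longRoot])
    exact e ▸ hlong _ _ h
  | qlDiag i a ha =>
    have e : σ = longRoot (.inr i) a := Units.ext (by simp [← hM, longRoot])
    exact e ▸ hlong _ _ (by simpa [FormParameter.mem_longCoeff, indexUnit] using ha)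

end RootsGenerate

/-! ### Continuity of conjugation over a localization -/

section FormLocalization

/-- `φ` behaves like a localization of form rings at the multiplicative set `T` of scalars. -/
structure IsFormLocalization {R R' : Type*} [Ring R] [StarRing R] [Ring R'] [StarRing R'] {lam : R}
    {lam' : R'} (Λ : FormParameter lam) (Λ' : FormParameter lam') (T : Submonoid R)
    (φ : R →+* R') : Prop extends IsFormHom Λ Λ' φ where
  scalar : ∀ t ∈ T, IsFormScalar Λ t
  scalar_map : ∀ t ∈ T, IsFormScalar Λ' (φ t)
  exists_denom : ∀ b, ∃ t ∈ T, ∃ a, φ t * b = φ a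
  exists_denom_mem : ∀ b ∈ Λ'.toAddSubgroup, ∃ t ∈ T, ∃ a ∈ Λ.toAddSubgroup, φ t * b = φ a
  exists_mul_eq_zero : ∀ a, φ a = 0 → ∃ t ∈ T, t * a = 0

variable {R R' : Type*} [Ring R] [StarRing R] [Ring R'] [StarRing R'] {lam : R} {lam' : R'}

/-- The group generated by the images of the root elements with coefficient divisible by `t`. -/
def rootSubgroup (n : ℕ) (lam' : R') (Λ : FormParameter lam) (φ : R →+* R') (t : R) :
    Subgroup (Matrix (Fin n ⊕ Fin n) (Fin n ⊕ Fin n) R')ˣ :=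
  Subgroup.closure
    ({σ | ∃ (i j : Fin n ⊕ Fin n) (h : i ≠ j) (h' : i ≠ j.swap) (a : R),
        σ = shortRoot lam' h h' (φ (t * a))} ∪
      {σ | ∃ (i : Fin n ⊕ Fin n), ∃ a ∈ Λ.longCoeff i, σ = longRoot i (φ (t * a))})

variable {n : ℕ} {Λ : FormParameter lam} {Λ' : FormParameter lam'} {T : Submonoid R} {φ : R →+* R'}

theorem shortRoot_mem_rootSubgroup {t : R} {i j : Fin n ⊕ Fin n} (h : i ≠ j) (h' : i ≠ j.swap)
    {b : R'} (a : R) (hb : b = φ (t * a)) :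
    shortRoot lam' h h' b ∈ rootSubgroup n lam' Λ φ t := by
  subst hb; exact Subgroup.subset_closure (Or.inl ⟨i, j, h, h', a, rfl⟩)

theorem longRoot_mem_rootSubgroup {t : R} {i : Fin n ⊕ Fin n} {b : R'} (a : R)
    (ha : a ∈ Λ.longCoeff i) (hb : b = φ (t * a)) :
    longRoot i b ∈ rootSubgroup n lam' Λ φ t := by
  subst hb; exact Subgroup.subset_closure (Or.inr ⟨i, a, ha, rfl⟩)

theorem rootSubgroup_le {t : R} {H : Subgroup (Matrix (Fin n ⊕ Fin n) (Fin n ⊕ Fin n) R')ˣ}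
    (hshort : ∀ (i j : Fin n ⊕ Fin n) (h : i ≠ j) (h' : i ≠ j.swap) (a : R),
      shortRoot lam' h h' (φ (t * a)) ∈ H)
    (hlong : ∀ (i : Fin n ⊕ Fin n), ∀ a ∈ Λ.longCoeff i, longRoot i (φ (t * a)) ∈ H) :
    rootSubgroup n lam' Λ φ t ≤ H := by
  refine (Subgroup.closure_le _).mpr ?_
  rintro _ (⟨i, j, h, h', a, rfl⟩ | ⟨i, a, ha, rfl⟩)
  exacts [hshort i j h h' a, hlong i a ha]

theorem conj_mem_of_mem_rootSubgroup {t : R}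
    {H : Subgroup (Matrix (Fin n ⊕ Fin n) (Fin n ⊕ Fin n) R')ˣ}
    {g : (Matrix (Fin n ⊕ Fin n) (Fin n ⊕ Fin n) R')ˣ}
    (hshort : ∀ (i j : Fin n ⊕ Fin n) (h : i ≠ j) (h' : i ≠ j.swap) (a : R),
      g * shortRoot lam' h h' (φ (t * a)) * g⁻¹ ∈ H)
    (hlong : ∀ (i : Fin n ⊕ Fin n), ∀ a ∈ Λ.longCoeff i, g * longRoot i (φ (t * a)) * g⁻¹ ∈ H) :
    ∀ x ∈ rootSubgroup n lam' Λ φ t, g * x * g⁻¹ ∈ H :=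
  rootSubgroup_le (H := H.comap (MulAut.conj g).toMonoidHom) hshort hlong

theorem IsFormHom.glMap_shortRoot (hφ : IsFormHom Λ Λ' φ) {i j : Fin n ⊕ Fin n} (h : i ≠ j)
    (h' : i ≠ j.swap) (a : R) :
    glMap _ φ (shortRoot lam h h' a) = shortRoot lam' h h' (φ a) := by
  ext1
  change φ.mapMatrix (shortMat lam i j a) = shortMat lam' i j (φ a)
  rw [shortMat, shortMat, map_sub, map_add, map_one, mapMatrix_single, mapMatrix_single,
    hφ.map_adjEntry]

theorem glMap_longRoot {R R' : Type*} [Ring R] [Ring R'] (φ : R →+* R') (i : Fin n ⊕ Fin n)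
    (a : R) : glMap _ φ (longRoot i a) = longRoot i (φ a) := by
  ext1
  change φ.mapMatrix (1 + Matrix.single i i.swap a) = 1 + Matrix.single i i.swap (φ a)
  rw [map_add, map_one, mapMatrix_single]

/-- This turns membership in a root subgroup over the localization into an elementary lift over the
base ring. -/
theorem rootSubgroup_le_map [IsCentralUnitary lam] (hφ : IsFormHom Λ Λ' φ) {t : R}
    (ht : IsFormScalar Λ t) :
    rootSubgroup n lam' Λ φ t ≤ (EQ n lam Λ).map (glMap _ φ) :=
  rootSubgroup_le
    (fun _ _ h h' a => ⟨_, shortRoot_mem_EQ h h' (t * a), hφ.glMap_shortRoot h h' _⟩)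
    fun i _ ha => ⟨_, longRoot_mem_EQ (ht.mul_mem_longCoeff ha), glMap_longRoot φ i _⟩

namespace IsFormLocalization

variable [IsCentralUnitary lam] [IsCentralUnitary lam'] {i j h k : Fin n ⊕ Fin n} {t s : R}

theorem exists_denom_longCoeff (hφ : IsFormLocalization Λ Λ' T φ) {b : R'}
    (hb : b ∈ Λ'.longCoeff i) : ∃ t ∈ T, ∃ a ∈ Λ.longCoeff i, φ t * b = φ a := by
  obtain ⟨t, ht, a, ha, e⟩ := hφ.exists_denom_mem _ hb
  refine ⟨t, ht, star (indexUnit lam i.swap) * a, ?_, ?_⟩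
  · rwa [FormParameter.mem_longCoeff, indexUnit_mul_star_mul]
  · rw [map_mul, hφ.map_star, hφ.map_indexUnit, ← e, AddMonoidHom.coe_mulLeft,
      ← mul_assoc, star_indexUnit_comm, mul_assoc, star_indexUnit_mul_mul]

/-- The commutator has coefficient bilinear in b and the conjugated coefficient, so one factor s
clears the denominator of b and t survives. If k = ρi, the new factor is a long root element with
coefficient in the image of Λ_min. -/
theorem short_conj_short_left (hφ : IsFormLocalization Λ Λ' T φ) (ht : t ∈ T) (hs : s ∈ T)
    (hij : i ≠ j) (hij' : i ≠ j.swap) (hjk : j ≠ k) (hjk' : j ≠ k.swap) (hik : i ≠ k)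
    {b : R'} {b₀ : R} (hb : φ s * b = φ b₀) (a : R) :
    shortRoot lam' hij hij' b * shortRoot lam' hjk hjk' (φ (t * s * a))
      * (shortRoot lam' hij hij' b)⁻¹ ∈ rootSubgroup n lam' Λ φ t := by
  have hba : b * φ (t * s * a) = φ (t * (b₀ * a)) := by
    rw [map_mul, map_mul, map_mul, map_mul, ← mul_assoc, ← mul_assoc, ← (hφ.scalar_map t ht).comm,
      mul_assoc (φ t), ← (hφ.scalar_map s hs).comm, hb, mul_assoc]
  have hx : shortRoot lam' hjk hjk' (φ (t * s * a)) ∈ rootSubgroup n lam' Λ φ t :=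
    shortRoot_mem_rootSubgroup _ _ (s * a) (by rw [mul_assoc])
  by_cases hik' : i = k.swap
  · obtain rfl : k = i.swap := by rw [hik', Sum.swap_swap]
    rw [shortRoot_mul_shortRoot_swap, mul_inv_cancel_right, hba]
    refine mul_mem (longRoot_mem_rootSubgroup _ (sub_adjEntry_mem_longCoeff Λ i (b₀ * a)) ?_) hx
    rw [mul_sub, map_sub, ← (hφ.scalar t ht).adjEntry_mul, hφ.map_adjEntry]
  · rw [shortRoot_mul_shortRoot _ _ _ _ hik hik', mul_inv_cancel_right, hba]
    exact mul_mem (shortRoot_mem_rootSubgroup _ _ _ rfl) hx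

/-- Away from the opposite root, whose two names are excluded by `h₁` and `h₂`, two short root
elements either commute or reduce by flips to the composable case. -/
theorem short_conj_short (hφ : IsFormLocalization Λ Λ' T φ) (ht : t ∈ T) (hs : s ∈ T)
    (hij : i ≠ j) (hij' : i ≠ j.swap) (hhk : h ≠ k) (hhk' : h ≠ k.swap)
    (h₁ : ¬(h = j ∧ k = i)) (h₂ : ¬(h = i.swap ∧ k = j.swap))
    {b : R'} {b₀ : R} (hb : φ s * b = φ b₀) (a : R) :
    shortRoot lam' hij hij' b * shortRoot lam' hhk hhk' (φ (t * s * a))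
      * (shortRoot lam' hij hij' b)⁻¹ ∈ rootSubgroup n lam' Λ φ t := by
  have hts : t * s ∈ T := mul_mem ht hs
  have hb' : φ s * -adjEntry lam' i j b = φ (-adjEntry lam i j b₀) := by
    rw [mul_neg, ← (hφ.scalar_map s hs).adjEntry_mul, hb, map_neg, hφ.map_adjEntry]
  have ha' : -adjEntry lam' h k (φ (t * s * a)) = φ (t * s * -adjEntry lam h k a) := by
    rw [← hφ.map_adjEntry, (hφ.scalar _ hts).adjEntry_mul, mul_neg, map_neg]
  by_cases c₁ : h = j
  · subst c₁
    exact hφ.short_conj_short_left ht hs _ _ _ _ (fun e => h₁ ⟨rfl, e.symm⟩) hb a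
  by_cases c₂ : k = j.swap
  · subst c₂
    rw [shortRoot_flip_of_eq hhk hhk' (i' := j) (j' := h.swap) (swap_ne.mp hhk.symm)
      (by simpa using Ne.symm c₁) (by simp) rfl, ha']
    exact hφ.short_conj_short_left ht hs _ _ _ _ (fun e => h₂ ⟨by simp [e], rfl⟩) hb _
  by_cases c₃ : k = i
  · subst c₃
    rw [shortRoot_flip hhk, shortRoot_flip hij, ha']
    exact hφ.short_conj_short_left ht hs _ _ _ _ (fun e => c₁ (swap_inj.mp e).symm) hb' _
  by_cases c₄ : h = i.swap
  · subst c₄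
    rw [shortRoot_flip hij]
    exact hφ.short_conj_short_left ht hs _ _ _ _ (Ne.symm c₂) hb' _
  rw [(shortRoot_comm hij hij' hhk hhk' c₁ c₄ c₃ c₂ _ _).eq, mul_inv_cancel_right]
  exact shortRoot_mem_rootSubgroup _ _ (s * a) (by rw [mul_assoc])

/-- The long factor of the commutator is quadratic in b, so its denominator has to be cleared twice;
hence the factor s * s. -/
theorem short_conj_long_left (hφ : IsFormLocalization Λ Λ' T φ) (ht : t ∈ T) (hs : s ∈ T)
    (hij : i ≠ j) (hij' : i ≠ j.swap) {b : R'} {b₀ : R} (hb : φ s * b = φ b₀) {a : R}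
    (ha : a ∈ Λ.longCoeff j) :
    shortRoot lam' hij hij' b * longRoot j (φ (t * s * s * a))
      * (shortRoot lam' hij hij' b)⁻¹ ∈ rootSubgroup n lam' Λ φ t := by
  have hss : IsFormScalar Λ (s * s) := (hφ.scalar s hs).mul (hφ.scalar s hs)
  have ht' := hφ.scalar_map t ht
  have hs' := hφ.scalar_map s hs
  have hba : b * φ (t * s * s * a) = φ (t * (s * b₀ * a)) := by
    simp only [map_mul, mul_assoc]
    rw [ht'.left_comm b, hs'.left_comm b, hs'.left_comm b, ← mul_assoc (φ s) b, hb]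
  have hbab : b * φ (t * s * s * a) * adjEntry lam' i j b = φ (t * (b₀ * a * adjEntry lam i j b₀)) := by
    rw [hba]
    calc _ = φ t * (φ b₀ * φ a * (φ s * adjEntry lam' i j b)) := by
          rw [← mul_assoc _ (φ s), ← hs'.comm]; simp only [map_mul, mul_assoc]
      _ = _ := by
          rw [← hs'.adjEntry_mul, hb, ← hφ.map_adjEntry]; simp only [map_mul]
  have hL : φ (t * s * s * a) ∈ Λ'.longCoeff j := hφ.map_mem_longCoeff <| by
    rw [mul_assoc t, mul_assoc t]
    exact (hφ.scalar t ht).mul_mem_longCoeff (hss.mul_mem_longCoeff ha)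
  rw [shortRoot_mul_longRoot hij hij' (by simpa using hij) b hL, mul_inv_cancel_right, hbab, hba]
  refine mul_mem (mul_mem ?_ ?_) ?_
  · exact longRoot_mem_rootSubgroup _ (hss.mul_mem_longCoeff ha) (by simp only [mul_assoc])
  · exact longRoot_mem_rootSubgroup _ (mul_mul_adjEntry_mem_longCoeff ha b₀) rfl
  · exact shortRoot_mem_rootSubgroup _ _ _ rfl

theorem short_conj_long (hφ : IsFormLocalization Λ Λ' T φ) (ht : t ∈ T) (hs : s ∈ T)
    (hij : i ≠ j) (hij' : i ≠ j.swap) {b : R'} {b₀ : R} (hb : φ s * b = φ b₀) {a : R}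
    (ha : a ∈ Λ.longCoeff h) :
    shortRoot lam' hij hij' b * longRoot h (φ (t * s * s * a))
      * (shortRoot lam' hij hij' b)⁻¹ ∈ rootSubgroup n lam' Λ φ t := by
  by_cases c₁ : h = j
  · subst c₁; exact hφ.short_conj_long_left ht hs _ _ hb ha
  by_cases c₂ : h = i.swap
  · subst c₂
    rw [shortRoot_flip hij]
    refine hφ.short_conj_long_left ht hs _ _ (b₀ := -adjEntry lam i j b₀) ?_ ha
    rw [mul_neg, ← (hφ.scalar_map s hs).adjEntry_mul, hb, map_neg, hφ.map_adjEntry]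
  rw [(shortRoot_longRoot_comm hij hij' c₁ c₂ _ _).eq, mul_inv_cancel_right]
  exact longRoot_mem_rootSubgroup _ (((hφ.scalar s hs).mul (hφ.scalar s hs)).mul_mem_longCoeff ha)
    (by simp only [mul_assoc])

/-- Now b enters linearly and the divisible coefficient quadratically, so one factor s is enough. -/
theorem long_conj_short_right (hφ : IsFormLocalization Λ Λ' T φ) (ht : t ∈ T) (hs : s ∈ T)
    {b : R'} {b₀ : R} (hb : φ s * b = φ b₀) (hb' : b ∈ Λ'.longCoeff i) (hb₀ : b₀ ∈ Λ.longCoeff i)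
    (hhi : h ≠ i) (hhi' : h ≠ i.swap) (a : R) :
    longRoot i b * shortRoot lam' hhi hhi' (φ (t * s * a)) * (longRoot i b)⁻¹
      ∈ rootSubgroup n lam' Λ φ t := by
  have hts := (hφ.scalar t ht).mul (hφ.scalar s hs)
  have ht' := hφ.scalar_map t ht
  have hs' := hφ.scalar_map s hs
  have hab : φ (t * s * a) * b = φ (t * (a * b₀)) := by
    rw [mul_assoc, (hφ.scalar s hs).comm, map_mul, map_mul, map_mul, map_mul, ← hb]
    simp only [mul_assoc]
  have haba : φ (t * s * a) * b * adjEntry lam' h i (φ (t * s * a))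
      = φ (t * (t * s * (a * b₀ * adjEntry lam h i a))) := by
    rw [hab, ← hφ.map_adjEntry, hts.adjEntry_mul, ← map_mul, mul_assoc t (a * b₀),
      ← mul_assoc (a * b₀), ← hts.comm (a * b₀), mul_assoc (t * s)]
  -- The commutator formula has the long root element on the right of the short one. It is used for
  -- -b, the inverse occurring in the conjugate.
  have key := shortRoot_mul_longRoot (Λ := Λ') hhi hhi' (by simpa using hhi) (φ (t * s * a))
    (neg_mem hb')
  have e : longRoot i b * shortRoot lam' hhi hhi' (φ (t * s * a)) * (longRoot i b)⁻¹
      = longRoot i b * (shortRoot lam' hhi hhi' (φ (t * s * a)) * longRoot i (-b)) := by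
    rw [longRoot_inv, mul_assoc]
  rw [e, key, ← longRoot_inv, mul_assoc (longRoot i b)⁻¹, mul_assoc (longRoot i b)⁻¹, mul_inv_cancel_left,
    mul_neg, neg_mul, hab, ← hab, haba, hab]
  refine mul_mem (mul_mem ?_ ?_) ?_
  · exact longRoot_mem_rootSubgroup (-(t * s * (a * b₀ * adjEntry lam h i a)))
      (neg_mem (hts.mul_mem_longCoeff (mul_mul_adjEntry_mem_longCoeff hb₀ a)))
      (by rw [mul_neg, map_neg])
  · exact shortRoot_mem_rootSubgroup _ _ (-(a * b₀)) (by rw [mul_neg, map_neg])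
  · exact shortRoot_mem_rootSubgroup _ _ (s * a) (by rw [mul_assoc])

theorem long_conj_short (hφ : IsFormLocalization Λ Λ' T φ) (ht : t ∈ T) (hs : s ∈ T)
    {b : R'} {b₀ : R} (hb : φ s * b = φ b₀) (hb' : b ∈ Λ'.longCoeff i) (hb₀ : b₀ ∈ Λ.longCoeff i)
    (hhk : h ≠ k) (hhk' : h ≠ k.swap) (a : R) :
    longRoot i b * shortRoot lam' hhk hhk' (φ (t * s * a)) * (longRoot i b)⁻¹
      ∈ rootSubgroup n lam' Λ φ t := by
  by_cases c₁ : k = i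
  · subst c₁; exact hφ.long_conj_short_right ht hs hb hb' hb₀ _ _ a
  by_cases c₂ : h = i.swap
  · subst c₂
    rw [shortRoot_flip_of_eq hhk hhk' (i' := k.swap) (j' := i) (swap_ne.mpr hhk.symm |> fun e => e)
      (fun e => c₁ (swap_inj.mp e)) rfl (by simp), ← hφ.map_adjEntry,
      ((hφ.scalar t ht).mul (hφ.scalar s hs)).adjEntry_mul, ← map_neg, ← mul_neg]
    exact hφ.long_conj_short_right ht hs hb hb' hb₀ _ _ _
  rw [← (shortRoot_longRoot_comm hhk hhk' (Ne.symm c₁) (fun e => c₂ (by simp [e])) _ _).eq,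
    mul_inv_cancel_right]
  exact shortRoot_mem_rootSubgroup _ _ (s * a) (by rw [mul_assoc])

theorem long_conj_long (hφ : IsFormLocalization Λ Λ' T φ) (hs : s ∈ T) (b : R') {a : R}
    (ha : a ∈ Λ.longCoeff h) (hh : h ≠ i.swap) :
    longRoot i b * longRoot h (φ (t * s * a)) * (longRoot i b)⁻¹
      ∈ rootSubgroup n lam' Λ φ t := by
  rw [(longRoot_comm hh _ _).eq, mul_inv_cancel_right]
  exact longRoot_mem_rootSubgroup _ ((hφ.scalar s hs).mul_mem_longCoeff ha) (by rw [mul_assoc])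

theorem exists_index_ne (hn : 3 ≤ n) (i j : Fin n ⊕ Fin n) :
    ∃ l : Fin n ⊕ Fin n, l ≠ i ∧ l ≠ i.swap ∧ l ≠ j ∧ l ≠ j.swap := by
  obtain ⟨p, hp⟩ : ∃ p : Fin n, p ∉ ({Sum.elim id id i, Sum.elim id id j} : Finset (Fin n)) := by
    by_contra! hall
    have h1 : (Finset.univ : Finset (Fin n)).card ≤ _ :=
      Finset.card_le_card fun p _ => hall p
    have h2 := h1.trans Finset.card_le_two
    rw [Finset.card_univ, Fintype.card_fin] at h2
    omega
  refine ⟨.inl p, ?_⟩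
  rcases i with i | i <;> rcases j with j | j <;> simpa using hp

/-- No commutator formula covers opposite roots. With a third index l, the element at (j, i) is the
commutator of elements at (j, l) and (l, i), neither opposite to (i, j). Each of the two needs its
own factor t * s, whence the square. -/
theorem short_conj_short_opposite (hφ : IsFormLocalization Λ Λ' T φ) (hn : 3 ≤ n) (ht : t ∈ T)
    (hs : s ∈ T) (hij : i ≠ j) (hij' : i ≠ j.swap) (hji : j ≠ i) (hji' : j ≠ i.swap)
    {b : R'} {b₀ : R} (hb : φ s * b = φ b₀) (a : R) :
    shortRoot lam' hij hij' b * shortRoot lam' hji hji' (φ (t * s * (t * s * a)))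
      * (shortRoot lam' hij hij' b)⁻¹ ∈ rootSubgroup n lam' Λ φ t := by
  obtain ⟨l, hli, hli', hlj, hlj'⟩ := exists_index_ne hn i j
  have hjl' : j ≠ l.swap := fun e => hlj' (by simp [e])
  have e := shortRoot_mul_shortRoot (lam := lam') hlj.symm hjl' hli hli' hji hji'
    (φ (t * s * 1)) (φ (t * s * a))
  rw [← map_mul, mul_one, mul_assoc, ← mul_assoc] at e
  rw [eq_mul_inv_of_mul_eq (eq_mul_inv_of_mul_eq e.symm), ← MulAut.conj_apply, map_mul, map_mul,
    map_mul, map_inv, map_inv]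
  have h1 := hφ.short_conj_short ht hs hij hij' hlj.symm hjl' (fun h => hli h.2)
    (fun h => hji' h.1) hb 1
  have h2 := hφ.short_conj_short ht hs hij hij' hli hli' (fun h => hlj h.1)
    (fun h => hij' h.2) hb a
  rw [mul_one] at h1
  rw [← MulAut.conj_apply] at h1 h2
  exact mul_mem (mul_mem (mul_mem h1 h2) (inv_mem h1)) (inv_mem h2)

/-- The long root element at h is recovered from the commutator of a short element at (h, j) with a
long one at j. Its coefficient is quadratic in the short coefficient and linear in the long one,
which accounts for the cube of t * s. -/
theorem long_conj_long_opposite (hφ : IsFormLocalization Λ Λ' T φ) (hn : 3 ≤ n) (ht : t ∈ T)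
    (hs : s ∈ T) {b : R'} {b₀ : R} (hb : φ s * b = φ b₀) (hb' : b ∈ Λ'.longCoeff h.swap)
    (hb₀ : b₀ ∈ Λ.longCoeff h.swap) {a : R} (ha : a ∈ Λ.longCoeff h) :
    longRoot h.swap b * longRoot h (φ (t * s * (t * s * (t * s * a)))) * (longRoot h.swap b)⁻¹
      ∈ rootSubgroup n lam' Λ φ t := by
  obtain ⟨j, hj, hj', -⟩ := exists_index_ne hn h h
  have hts := (hφ.scalar t ht).mul (hφ.scalar s hs)
  have hhj' : h ≠ j.swap := fun e => hj' (by simp [e])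
  -- Transport of a from index h to j along a unit coefficient; transporting back from j to h
  -- restores a.
  set c := a * adjEntry lam j h 1 with hc
  have hcmem : c ∈ Λ.longCoeff j := by
    simpa using mul_mul_adjEntry_mem_longCoeff (i := j) ha 1
  have hca : c * adjEntry lam h j 1 = a := by
    rw [hc, mul_assoc, ← adjEntry_mul, mul_one, adjEntry, indexUnit_mul_star, star_one, mul_one,
      mul_one]
  have hc' : φ (t * s * c) ∈ Λ'.longCoeff j := hφ.map_mem_longCoeff (hts.mul_mem_longCoeff hcmem)
  have e := shortRoot_mul_longRoot (lam := lam') hj.symm hhj' (by simpa using hj.symm)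
    (φ (t * s * 1)) hc'
  have hcoef : φ (t * s * 1) * φ (t * s * c) * adjEntry lam' h j (φ (t * s * 1))
      = φ (t * s * (t * s * (t * s * a))) := by
    rw [← hφ.map_adjEntry, hts.adjEntry_mul, ← map_mul, ← map_mul, mul_one]
    congr 1
    rw [mul_assoc (t * s) (t * s * c), mul_assoc (t * s) c, hts.left_comm c, hca]
  have hbc : φ (t * s * 1) * φ (t * s * c) = φ (t * s * (t * s * c)) := by
    rw [← map_mul, mul_one]
  have solve : ∀ {p q x r : (Matrix (Fin n ⊕ Fin n) (Fin n ⊕ Fin n) R')ˣ},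
      p * q = q * x * r * p → x = q⁻¹ * (p * q * p⁻¹) * r⁻¹ := by
    intro p q x r e; rw [e]; group
  rw [hcoef, hbc] at e
  rw [solve e, ← MulAut.conj_apply]
  simp only [map_mul (MulAut.conj _), map_inv (MulAut.conj _), MulAut.conj_apply]
  have h1 : longRoot h.swap b * longRoot j (φ (t * s * c)) * (longRoot h.swap b)⁻¹
      ∈ rootSubgroup n lam' Λ φ t := hφ.long_conj_long hs b hcmem (by simpa using hj)
  have h2 := hφ.long_conj_short ht hs hb hb' hb₀ hj.symm hhj' 1
  have h3 := hφ.long_conj_short ht hs hb hb' hb₀ hhj' (by simpa using hj.symm) (t * s * c)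
  exact mul_mem (mul_mem (inv_mem h1) (mul_mem (mul_mem h2 h1) (inv_mem h2))) (inv_mem h3)

theorem exists_short_conj_mem (hφ : IsFormLocalization Λ Λ' T φ) (hn : 3 ≤ n) (hij : i ≠ j)
    (hij' : i ≠ j.swap) (b : R') (ht : t ∈ T) : ∃ t' ∈ T, ∀ x ∈ rootSubgroup n lam' Λ φ t',
      shortRoot lam' hij hij' b * x * (shortRoot lam' hij hij' b)⁻¹
        ∈ rootSubgroup n lam' Λ φ t := by
  obtain ⟨s, hs, b₀, hb⟩ := hφ.exists_denom b
  have hst := mul_mem ht hs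
  have hts := hφ.scalar _ hst
  refine ⟨t * s * (t * s), mul_mem hst hst,
    conj_mem_of_mem_rootSubgroup (fun h k hhk hhk' a => ?_) fun h a ha => ?_⟩
  · by_cases c₁ : h = j ∧ k = i
    · obtain ⟨rfl, rfl⟩ := c₁
      rw [mul_assoc (t * s)]
      exact hφ.short_conj_short_opposite hn ht hs _ _ _ _ hb a
    by_cases c₂ : h = i.swap ∧ k = j.swap
    · obtain ⟨rfl, rfl⟩ := c₂
      rw [shortRoot_flip_of_eq hhk hhk' hij.symm (swap_ne.mp hij'.symm) (by simp) (by simp),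
        ← hφ.map_adjEntry, (hts.mul hts).adjEntry_mul, ← map_neg, ← mul_neg, mul_assoc (t * s)]
      exact hφ.short_conj_short_opposite hn ht hs _ _ _ _ hb _
    rw [mul_assoc (t * s)]
    exact hφ.short_conj_short ht hs _ _ _ _ c₁ c₂ hb _
  · have e : t * s * (t * s) * a = t * s * s * (t * a) := by
      rw [(hφ.scalar t ht).left_comm (t * s * s), (hφ.scalar t ht).left_comm (t * s)]
      simp only [mul_assoc]
    rw [e]
    exact hφ.short_conj_long ht hs _ _ hb ((hφ.scalar t ht).mul_mem_longCoeff ha)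

theorem exists_long_conj_mem (hφ : IsFormLocalization Λ Λ' T φ) (hn : 3 ≤ n) {b : R'}
    (hb' : b ∈ Λ'.longCoeff i) (ht : t ∈ T) : ∃ t' ∈ T, ∀ x ∈ rootSubgroup n lam' Λ φ t',
      longRoot i b * x * (longRoot i b)⁻¹ ∈ rootSubgroup n lam' Λ φ t := by
  obtain ⟨s, hs, b₀, hb₀, hb⟩ := hφ.exists_denom_longCoeff hb'
  have hst := mul_mem ht hs
  have hts := hφ.scalar _ hst
  refine ⟨t * s * (t * s * (t * s)), mul_mem hst (mul_mem hst hst),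
    conj_mem_of_mem_rootSubgroup (fun h k hhk hhk' a => ?_) fun h a ha => ?_⟩
  · rw [mul_assoc (t * s)]
    exact hφ.long_conj_short ht hs hb hb' hb₀ _ _ _
  · rw [mul_assoc (t * s), mul_assoc (t * s)]
    by_cases c : h = i.swap
    · obtain rfl : i = h.swap := by simp [c]
      exact hφ.long_conj_long_opposite hn ht hs hb hb' hb₀ ha
    · exact hφ.long_conj_long hs b (hts.mul_mem_longCoeff (hts.mul_mem_longCoeff ha)) c

/-- Conjugation by an elementary matrix is continuous for the filtration by the root subgroups. -/
theorem exists_conj_mem (hφ : IsFormLocalization Λ Λ' T φ) (hn : 3 ≤ n)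
    {g : (Matrix (Fin n ⊕ Fin n) (Fin n ⊕ Fin n) R')ˣ} (hg : g ∈ EQ n lam' Λ') (ht : t ∈ T) :
    ∃ t' ∈ T, ∀ x ∈ rootSubgroup n lam' Λ φ t', g * x * g⁻¹ ∈ rootSubgroup n lam' Λ φ t := by
  -- The condition is imposed on g and g⁻¹ together and for all t, so that it is stable under
  -- inverses and products; then generators suffice.
  let H : Subgroup (Matrix (Fin n ⊕ Fin n) (Fin n ⊕ Fin n) R')ˣ :=
    { carrier := {g | (∀ t ∈ T, ∃ t' ∈ T, ∀ x ∈ rootSubgroup n lam' Λ φ t',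
          g * x * g⁻¹ ∈ rootSubgroup n lam' Λ φ t) ∧
        ∀ t ∈ T, ∃ t' ∈ T, ∀ x ∈ rootSubgroup n lam' Λ φ t',
          g⁻¹ * x * g⁻¹⁻¹ ∈ rootSubgroup n lam' Λ φ t}
      one_mem' := ⟨fun t ht => ⟨t, ht, by simp⟩, fun t ht => ⟨t, ht, by simp⟩⟩
      mul_mem' := by
        rintro a b ⟨ha, ha'⟩ ⟨hb, hb'⟩
        refine ⟨fun t ht => ?_, fun t ht => ?_⟩
        · obtain ⟨t₁, ht₁, h₁⟩ := ha t ht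
          obtain ⟨t₂, ht₂, h₂⟩ := hb t₁ ht₁
          refine ⟨t₂, ht₂, fun x hx => ?_⟩
          simpa only [mul_inv_rev, mul_assoc] using h₁ _ (h₂ x hx)
        · obtain ⟨t₁, ht₁, h₁⟩ := hb' t ht
          obtain ⟨t₂, ht₂, h₂⟩ := ha' t₁ ht₁
          refine ⟨t₂, ht₂, fun x hx => ?_⟩
          simpa only [mul_inv_rev, mul_assoc] using h₁ _ (h₂ x hx)
      inv_mem' := by
        rintro a ⟨ha, ha'⟩
        exact ⟨ha', by simpa only [inv_inv] using ha⟩ }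
  have hH : EQ n lam' Λ' ≤ H := by
    refine EQ_le_of_roots (fun i j h h' b => ⟨fun t ht => ?_, fun t ht => ?_⟩)
      fun i b hb => ⟨fun t ht => ?_, fun t ht => ?_⟩
    · exact hφ.exists_short_conj_mem hn h h' b ht
    · rw [shortRoot_inv]; exact hφ.exists_short_conj_mem hn h h' _ ht
    · exact hφ.exists_long_conj_mem hn hb ht
    · rw [longRoot_inv]; exact hφ.exists_long_conj_mem hn (neg_mem hb) ht
  exact (hH hg).1 t ht

end IsFormLocalization

end FormLocalization

/-! ### The dilation principle -/

section Dilation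

variable {R R' : Type*} [Ring R] [StarRing R] [Ring R'] [StarRing R'] {lam : R} {lam' : R'}

/-- This finds a common denominator for finitely many conditions, each stable under multiplying the
denominator by elements of T. -/
theorem exists_common_mem {R ι : Type*} [Monoid R] (T : Submonoid R) {Q : ι → R → Prop}
    (hQ : ∀ i, ∀ t ∈ T, ∀ s ∈ T, Q i t → Q i (t * s) ∧ Q i (s * t)) (h : ∀ i, ∃ t ∈ T, Q i t)
    (S : Finset ι) : ∃ t ∈ T, ∀ i ∈ S, Q i t := by
  classical
  induction S using Finset.induction_on with
  | empty => exact ⟨1, one_mem T, by simp⟩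
  | insert i S _ ih =>
    obtain ⟨t, ht, hS⟩ := ih
    obtain ⟨s, hs, hi⟩ := h i
    refine ⟨t * s, mul_mem ht hs, fun k hk => ?_⟩
    obtain rfl | hk := Finset.mem_insert.mp hk
    · exact (hQ k s hs t ht hi).2
    · exact (hQ k t ht s hs (hS k hk)).1

variable {Λ : FormParameter lam} {Λ' : FormParameter lam'} {T : Submonoid R} {φ : R →+* R'}

theorem IsFormLocalization.exists_polynomial_denom (hφ : IsFormLocalization Λ Λ' T φ)
    (M : AddSubgroup R) (hM : ∀ t ∈ T, ∀ a ∈ M, t * a ∈ M) (p : R'[X])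
    (hp : ∀ k, ∃ t ∈ T, ∃ a ∈ M, φ t * p.coeff k = φ a) :
    ∃ t ∈ T, ∃ q : R[X], (∀ k, q.coeff k ∈ M) ∧ C (φ t) * p = q.map φ := by
  obtain ⟨t, ht, h⟩ := exists_common_mem T
    (Q := fun k t => ∃ a ∈ M, φ t * p.coeff k = φ a) (fun k t ht s hs => by
      rintro ⟨a, ha, e⟩
      have h : ∃ b ∈ M, φ (s * t) * p.coeff k = φ b :=
        ⟨s * a, hM s hs a ha, by rw [map_mul, mul_assoc, e, map_mul]⟩
      exact ⟨(hφ.scalar t ht).comm s ▸ h, h⟩) hp p.support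
  choose! a haM ha using h
  refine ⟨t, ht, ∑ k ∈ p.support, monomial k (a k), fun k => ?_, ?_⟩
  · simp only [finsetSum_coeff, coeff_monomial, Finset.sum_ite_eq']
    split_ifs with hk
    exacts [haM k hk, zero_mem M]
  · ext k
    simp only [coeff_C_mul, coeff_map, finsetSum_coeff, coeff_monomial, Finset.sum_ite_eq']
    split_ifs with hk
    · exact ha k hk
    · rw [notMem_support_iff.mp hk, mul_zero, map_zero]

variable [IsCentralUnitary lam] [IsCentralUnitary lam']

/-- A polynomial has finitely many coefficients, so a common denominator exists and constants
suffice as denominators. Thus everything proved for a localization also holds with a variable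
adjoined. -/
theorem IsFormLocalization.polynomial (hφ : IsFormLocalization Λ Λ' T φ) :
    IsFormLocalization Λ.polynomial Λ'.polynomial (T.map (C : R →+* R[X])) (mapRingHom φ) where
  toIsFormHom := hφ.toIsFormHom.polynomial
  scalar := by
    rintro _ ⟨t, ht, rfl⟩
    exact (hφ.scalar t ht).C
  scalar_map := by
    rintro _ ⟨t, ht, rfl⟩
    simpa using (hφ.scalar_map t ht).C
  exists_denom p := by
    obtain ⟨t, ht, q, -, e⟩ := hφ.exists_polynomial_denom ⊤ (fun _ _ _ _ => trivial) p fun k => by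
      obtain ⟨t, ht, a, e⟩ := hφ.exists_denom (p.coeff k)
      exact ⟨t, ht, a, trivial, e⟩
    exact ⟨C t, ⟨t, ht, rfl⟩, q, by simpa using e⟩
  exists_denom_mem p hp := by
    obtain ⟨t, ht, q, hq, e⟩ := hφ.exists_polynomial_denom Λ.toAddSubgroup
      (fun t ht => (hφ.scalar t ht).mul_mem) p fun k => hφ.exists_denom_mem _ (hp k)
    exact ⟨C t, ⟨t, ht, rfl⟩, q, hq, by simpa using e⟩
  exists_mul_eq_zero p hp := by
    obtain ⟨t, ht, h⟩ := exists_common_mem T (Q := fun k t => t * p.coeff k = 0)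
      (fun k t ht s hs e => by
        have h : s * t * p.coeff k = 0 := by rw [mul_assoc, e, mul_zero]
        exact ⟨(hφ.scalar t ht).comm s ▸ h, h⟩)
      (fun k => hφ.exists_mul_eq_zero (p.coeff k) (by
        have := congrArg (fun q => coeff q k) hp
        simpa using this)) p.support
    refine ⟨C t, ⟨t, ht, rfl⟩, ?_⟩
    ext k
    rw [coeff_C_mul, coeff_zero]
    by_cases hk : k ∈ p.support
    · exact h k hk
    · rw [notMem_support_iff.mp hk, mul_zero]

theorem FormParameter.mem_longCoeff_polynomial {n : ℕ} {i : Fin n ⊕ Fin n} {p : R[X]} :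
    p ∈ Λ.polynomial.longCoeff i ↔ ∀ k, p.coeff k ∈ Λ.longCoeff i := by
  have h : indexUnit (C lam) i.swap = C (indexUnit lam i.swap) := by
    rcases i with i | i <;> simp [indexUnit]
  simp only [mem_longCoeff, h, mem_polynomial, coeff_C_mul]

/-- The substitution `X ↦ c X` for a scalar `c`. -/
noncomputable def scaleHom {c : R} (hc : IsFormScalar Λ c) : R[X] →+* R[X] :=
  evalHom C (hc.C.mul IsFormScalar.X)

theorem isFormHom_scaleHom {c : R} (hc : IsFormScalar Λ c) :
    IsFormHom Λ.polynomial Λ.polynomial (scaleHom hc) :=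
  IsFormHom.C.evalHom _

theorem coeff_scaleHom {c : R} (hc : IsFormScalar Λ c) (p : R[X]) (k : ℕ) :
    (scaleHom hc p).coeff k = c ^ k * p.coeff k := by
  induction p using Polynomial.induction_on' with
  | add p q hp hq => rw [map_add, coeff_add, coeff_add, hp, hq, mul_add]
  | monomial m a =>
    rw [scaleHom, evalHom_apply, eval₂_monomial, (commute_X (C c)).symm.mul_pow, ← C_pow,
      ← mul_assoc, ← C_mul, coeff_C_mul_X_pow, coeff_monomial, ← (hc.pow m).comm]
    split_ifs with h h' h'
    · rw [h]
    · exact absurd h.symm h'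
    · exact absurd h'.symm h
    · rw [mul_zero]

/-- The constant term of a polynomial, as a polynomial. -/
noncomputable def constHom (R : Type*) [Ring R] : R[X] →+* R[X] := C.comp constantCoeff

theorem constHom_apply {R : Type*} [Ring R] (p : R[X]) : constHom R p = C (p.coeff 0) := rfl

theorem isFormHom_constHom (Λ : FormParameter lam) :
    IsFormHom Λ.polynomial Λ.polynomial (constHom R) where
  map_star p := by simp [constHom_apply, coeff_star]
  map_lam := by simp [constHom_apply]
  map_mem p hp := IsFormHom.C.map_mem _ (hp 0)

theorem constHom_comp_scaleHom {c : R} (hc : IsFormScalar Λ c) :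
    (constHom R).comp (scaleHom hc) = constHom R := by
  refine RingHom.ext fun p => ?_
  simp [constHom_apply, coeff_scaleHom]

theorem mapRingHom_comp_constHom {R R' : Type*} [Ring R] [Ring R'] (φ : R →+* R') :
    (mapRingHom φ).comp (constHom R) = (constHom R').comp (mapRingHom φ) := by
  refine RingHom.ext fun p => ?_
  simp [constHom_apply]

theorem mapRingHom_comp_scaleHom {c : R} (hc : IsFormScalar Λ c) (hc' : IsFormScalar Λ' (φ c)) :
    (mapRingHom φ).comp (scaleHom hc) = (scaleHom hc').comp (mapRingHom φ) := by
  refine RingHom.ext fun p => Polynomial.ext fun k => ?_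
  simp [coeff_scaleHom]

theorem scaleHom_comp_scaleHom {c d e : R} (hc : IsFormScalar Λ c) (hd : IsFormScalar Λ d)
    (he : IsFormScalar Λ e) (h : e = c * d) : (scaleHom hc).comp (scaleHom hd) = scaleHom he := by
  subst h
  apply RingHom.ext; intro p; ext k
  rw [RingHom.comp_apply, coeff_scaleHom, coeff_scaleHom, coeff_scaleHom, ← mul_assoc,
    (Commute.mul_pow (hc.comm d))]

namespace IsFormLocalization

/-- Every nonconstant term of p(rX) carries a factor r = t₀t₁s: its t₁ clears the denominator of p,
and t₀ remains as the required divisor. -/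
theorem exists_scale_sub_const (hφ : IsFormLocalization Λ Λ' T φ) {t₀ t₁ : R}
    {p : R'[X]} {q : R[X]} (e : C (φ t₁) * p = q.map φ) {s r : R}
    (hs : s ∈ T) (hr : r ∈ T) (hrs : r = t₀ * t₁ * s) :
    scaleHom (hφ.scalar_map r hr) p - constHom R' p
      = mapRingHom φ (C t₀ * (C s * (X * scaleHom (hφ.scalar r hr) q.divX))) := by
  have hs' := hφ.scalar_map s hs
  have hr' := (hφ.scalar_map r hr).pow
  ext k
  rw [coeff_sub, coeff_scaleHom, constHom_apply, coe_mapRingHom, coeff_map, coeff_C_mul, coeff_C_mul]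
  cases k with
  | zero => simp
  | succ k =>
    have ek := congrArg (fun f => coeff f (k + 1)) e
    simp only [coeff_C_mul, coeff_map] at ek
    rw [coeff_C, if_neg (Nat.succ_ne_zero k), coeff_X_mul, coeff_scaleHom, coeff_divX, sub_zero,
      map_mul, map_mul, map_mul, map_pow, ← ek, pow_succ, mul_assoc]
    nth_rw 2 [hrs]
    rw [map_mul, map_mul, mul_assoc, mul_assoc, hs'.left_comm (φ t₁),
      (hr' k).left_comm (φ s), (hr' k).left_comm (φ t₀)]

/-- Each elementary polynomial matrix becomes, after division by its constant term and after
rescaling the variable, a product of root elements with coefficients divisible by `t₀`. -/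
theorem exists_scale_mem (hφ : IsFormLocalization Λ Λ' T φ) {n : ℕ} (hn : 3 ≤ n)
    {δ : (Matrix (Fin n ⊕ Fin n) (Fin n ⊕ Fin n) R'[X])ˣ} (hδ : δ ∈ EQ n (C lam') Λ'.polynomial)
    {t₀ : R} (ht₀ : t₀ ∈ T) :
    ∃ t ∈ T, ∀ s ∈ T, ∀ r, r = t * s → ∀ hr : r ∈ T,
      glMap _ (scaleHom (hφ.scalar_map r hr)) δ * (glMap _ (constHom R') δ)⁻¹
        ∈ rootSubgroup n (C lam') Λ.polynomial (mapRingHom φ) (C t₀) := by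
  have hT : ∀ {r t s : R}, t ∈ T → r = t * s → r = s * t := fun ht h => by
    rw [h, (hφ.scalar _ ht).comm]
  let H : Subgroup (Matrix (Fin n ⊕ Fin n) (Fin n ⊕ Fin n) R'[X])ˣ :=
    { carrier := {δ | δ ∈ EQ n (C lam') Λ'.polynomial ∧ ∀ t₀ ∈ T,
        ∃ t ∈ T, ∀ s ∈ T, ∀ r, r = t * s → ∀ hr : r ∈ T,
          glMap _ (scaleHom (hφ.scalar_map r hr)) δ * (glMap _ (constHom R') δ)⁻¹
            ∈ rootSubgroup n (C lam') Λ.polynomial (mapRingHom φ) (C t₀)}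
      one_mem' := ⟨one_mem _, fun t₀ _ => ⟨1, one_mem T, fun s _ r _ hr => by
        rw [map_one, map_one, inv_one, mul_one]; exact one_mem _⟩⟩
      mul_mem' := by
        rintro a b ⟨ha, ha'⟩ ⟨hb, hb'⟩
        refine ⟨mul_mem ha hb, fun t₀ ht₀ => ?_⟩
        -- With δ = ab, δ(rX)δ(0)⁻¹ is a(rX)a(0)⁻¹ times the conjugate of b(rX)b(0)⁻¹ by a(0). The
        -- factor for b must be made divisible by t₁, so that this conjugation lands at level t₀.
        obtain ⟨_, ⟨t₁, ht₁, rfl⟩, h₁⟩ := hφ.polynomial.exists_conj_mem hn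
          ((isFormHom_constHom Λ').map_mem_EQ ha) (Submonoid.mem_map_of_mem (C : R →+* R[X]) ht₀)
        obtain ⟨t₂, ht₂, h₂⟩ := ha' t₀ ht₀
        obtain ⟨t₃, ht₃, h₃⟩ := hb' t₁ ht₁
        refine ⟨t₂ * t₃, mul_mem ht₂ ht₃, fun s hs r hrs hr => ?_⟩
        have k₂ := h₂ (t₃ * s) (mul_mem ht₃ hs) r (by rw [hrs, mul_assoc]) hr
        have k₃ := h₁ _ (h₃ (t₂ * s) (mul_mem ht₂ hs) r
          (by rw [hrs, (hφ.scalar t₂ ht₂).comm, mul_assoc]) hr)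
        have := mul_mem k₂ k₃
        convert this using 1
        simp only [map_mul, mul_inv_rev]
        group
      inv_mem' := by
        rintro a ⟨ha, ha'⟩
        refine ⟨inv_mem ha, fun t₀ ht₀ => ?_⟩
        -- Similarly a(rX)⁻¹a(0) is the conjugate of (a(rX)a(0)⁻¹)⁻¹ by a(0)⁻¹.
        obtain ⟨_, ⟨t₁, ht₁, rfl⟩, h₁⟩ := hφ.polynomial.exists_conj_mem hn
          (inv_mem ((isFormHom_constHom Λ').map_mem_EQ ha))
          (Submonoid.mem_map_of_mem (C : R →+* R[X]) ht₀)
        obtain ⟨t₂, ht₂, h₂⟩ := ha' t₁ ht₁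
        refine ⟨t₂, ht₂, fun s hs r hrs hr => ?_⟩
        have := h₁ _ (inv_mem (h₂ s hs r hrs hr))
        convert this using 1
        simp only [map_inv]
        group }
  have hH : EQ n (C lam') Λ'.polynomial ≤ H := by
    refine EQ_le_of_roots (fun i j h h' p => ⟨shortRoot_mem_EQ h h' p, fun t₀ ht₀ => ?_⟩)
      fun i p hp => ⟨longRoot_mem_EQ hp, fun t₀ ht₀ => ?_⟩
    · obtain ⟨_, ⟨t₁, ht₁, rfl⟩, q, e⟩ := hφ.polynomial.exists_denom p
      refine ⟨t₀ * t₁, mul_mem ht₀ ht₁, fun s hs r hrs hr => ?_⟩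
      rw [(isFormHom_scaleHom _).glMap_shortRoot, (isFormHom_constHom Λ').glMap_shortRoot,
        shortRoot_inv, ← shortRoot_add, ← sub_eq_add_neg]
      exact shortRoot_mem_rootSubgroup _ _ _
        (hφ.exists_scale_sub_const (by simpa using e) hs hr hrs)
    · obtain ⟨_, ⟨t₁, ht₁, rfl⟩, q, hq, e⟩ := hφ.polynomial.exists_denom_longCoeff hp
      refine ⟨t₀ * t₁, mul_mem ht₀ ht₁, fun s hs r hrs hr => ?_⟩
      rw [glMap_longRoot, glMap_longRoot, longRoot_inv, ← longRoot_add, ← sub_eq_add_neg]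
      refine longRoot_mem_rootSubgroup _ ?_
        (hφ.exists_scale_sub_const (by simpa using e) hs hr hrs)
      refine (hφ.scalar s hs).C.mul_mem_longCoeff (IsFormScalar.X.mul_mem_longCoeff ?_)
      rw [FormParameter.mem_longCoeff_polynomial] at hq ⊢
      intro k
      rw [coeff_scaleHom, coeff_divX]
      exact ((hφ.scalar r hr).pow k).mul_mem_longCoeff (hq _)
  exact (hH hδ).2 t₀ ht₀

/-- The entries of β - 1 die in the localization, hence are killed by one denominator t.
Substituting tX multiplies each nonconstant coefficient by a positive power of t, and the constant
terms vanish already. -/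
theorem exists_scale_eq_one (hφ : IsFormLocalization Λ Λ' T φ) {ι : Type*} [Fintype ι]
    [DecidableEq ι] {β : (Matrix ι ι R[X])ˣ} (h₀ : glMap ι (constHom R) β = 1)
    (h₁ : glMap ι (mapRingHom φ) β = 1) :
    ∃ t, ∃ ht : t ∈ T, glMap ι (scaleHom (hφ.scalar t ht)) β = 1 := by
  obtain ⟨t, ht, h⟩ := exists_common_mem T (ι := ι × ι)
    (Q := fun x t => C t * (β.val x.1 x.2 - (1 : Matrix ι ι R[X]) x.1 x.2) = 0)
    (fun x t ht s hs e => by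
      have h : C (s * t) * (β.val x.1 x.2 - (1 : Matrix ι ι R[X]) x.1 x.2) = 0 := by
        rw [C_mul, mul_assoc, e, mul_zero]
      exact ⟨(hφ.scalar t ht).comm s ▸ h, h⟩)
    (fun x => by
      obtain ⟨_, ⟨t, ht, rfl⟩, e⟩ := hφ.polynomial.exists_mul_eq_zero
        (β.val x.1 x.2 - (1 : Matrix ι ι R[X]) x.1 x.2) (by
          rw [map_sub, ← glMap_apply, h₁, Units.val_one, Matrix.one_apply, Matrix.one_apply]
          split_ifs <;> simp)
      exact ⟨t, ht, e⟩) Finset.univ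
  refine ⟨t, ht, ?_⟩
  refine Units.ext (Matrix.ext fun i j => ?_)
  have h0 := congrArg (fun M : (Matrix ι ι R[X])ˣ => (M.val i j)) h₀
  simp only [glMap_apply] at h0
  have hone : ∀ f : R[X] →+* R[X], f ((1 : Matrix ι ι R[X]) i j) = (1 : Matrix ι ι R[X]) i j := by
    intro f; rw [Matrix.one_apply]; split_ifs <;> simp
  rw [glMap_apply, Units.val_one, ← sub_eq_zero]
  rw [Units.val_one, ← hone (constHom R), ← sub_eq_zero, ← map_sub] at h0
  rw [← hone (scaleHom (hφ.scalar t ht)), ← map_sub]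
  have hij := h (i, j) (Finset.mem_univ _)
  simp only at hij
  ext k
  rw [coeff_scaleHom, coeff_zero]
  cases k with
  | zero =>
    rw [constHom_apply, C_eq_zero] at h0
    rw [h0, mul_zero]
  | succ k =>
    have := congrArg (fun f => coeff f (k + 1)) hij
    simp only [coeff_C_mul, coeff_zero] at this
    rw [pow_succ, mul_assoc, this, mul_zero]

/-- A polynomial matrix with trivial constant term that is elementary over a localization becomes
elementary after rescaling the variable by a denominator. -/
theorem exists_scale_mem_EQ (hφ : IsFormLocalization Λ Λ' T φ) {n : ℕ} (hn : 3 ≤ n)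
    {γ : (Matrix (Fin n ⊕ Fin n) (Fin n ⊕ Fin n) R[X])ˣ} (h₀ : glMap _ (constHom R) γ = 1)
    (hγ : glMap _ (mapRingHom φ) γ ∈ EQ n (C lam') Λ'.polynomial) :
    ∃ t, ∃ ht : t ∈ T,
      glMap _ (scaleHom (hφ.scalar t ht)) γ ∈ EQ n (C lam) Λ.polynomial := by
  obtain ⟨t, ht, h⟩ := hφ.exists_scale_mem hn hγ (one_mem T)
  have h := h 1 (one_mem T) t (mul_one t).symm ht
  rw [glMap_glMap, glMap_glMap, ← mapRingHom_comp_constHom, ← glMap_glMap _ (constHom R), h₀,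
    map_one (glMap _ _), inv_one, mul_one, ← mapRingHom_comp_scaleHom (hφ.scalar t ht)] at h
  obtain ⟨ε, hε, e⟩ := rootSubgroup_le_map hφ.polynomial.toIsFormHom
    (hφ.polynomial.scalar _ ⟨1, one_mem T, rfl⟩) h
  -- The lift ε of γ(tX) is normalized to have constant term 1. Its image is unchanged, because ε(0)
  -- already maps to 1. Then β = γ(tX)ε'⁻¹ is trivial both at X = 0 and over the localization, so a
  -- further rescaling makes it 1.
  set ε' := ε * (glMap _ (constHom R) ε)⁻¹ with hε'
  have hε'mem : ε' ∈ EQ n (C lam) Λ.polynomial :=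
    mul_mem hε (inv_mem ((isFormHom_constHom Λ).map_mem_EQ hε))
  set β := glMap _ (scaleHom (hφ.scalar t ht)) γ * ε'⁻¹ with hβ
  have hconst : (constHom R).comp (constHom R) = constHom R := by
    refine RingHom.ext fun p => ?_
    simp [constHom_apply]
  have hβ₀ : glMap _ (constHom R) β = 1 := by
    rw [hβ, map_mul, map_inv, glMap_glMap, constHom_comp_scaleHom, h₀, hε', map_mul, map_inv,
      glMap_glMap, hconst, mul_inv_cancel, inv_one, mul_one]
  have hε₀ : glMap _ ((constHom R').comp (mapRingHom φ)) ε = 1 := by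
    rw [← glMap_glMap, e, glMap_glMap, ← RingHom.comp_assoc, ← mapRingHom_comp_constHom,
      RingHom.comp_assoc, constHom_comp_scaleHom, ← glMap_glMap, h₀, map_one]
  have hβ₁ : glMap _ (mapRingHom φ) β = 1 := by
    rw [hβ, map_mul, map_inv, glMap_glMap, hε', map_mul, map_inv, glMap_glMap,
      mapRingHom_comp_constHom, hε₀, e, inv_one, mul_one, mul_inv_cancel]
  obtain ⟨r, hr, k⟩ := hφ.exists_scale_eq_one hβ₀ hβ₁
  refine ⟨r * t, mul_mem hr ht, ?_⟩
  rw [hβ, map_mul, map_inv, glMap_glMap, scaleHom_comp_scaleHom _ _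
    (hφ.scalar _ (mul_mem hr ht)) rfl, mul_inv_eq_one] at k
  rw [k]
  exact (isFormHom_scaleHom _).map_mem_EQ hε'mem

end IsFormLocalization

end Dilation

/-! ### Arithmetic of fractions with central denominators -/

section LocalizedModule

variable {R : Type*} [Ring R] {S : Submonoid (Subring.center R)}

theorem toLoc_mul_mk (a b : R) (s : S) :
    toLoc S a * LocalizedModule.mk b s = LocalizedModule.mk (a * b) s := by
  rw [toLoc_apply, LocalizedModule.mk_mul_mk, one_mul]

theorem mk_mul_toLoc (a b : R) (s : S) :
    LocalizedModule.mk b s * toLoc S a = LocalizedModule.mk (b * a) s := by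
  rw [toLoc_apply, LocalizedModule.mk_mul_mk, mul_one]

theorem mk_coe_mul (a : R) (s t : S) :
    LocalizedModule.mk (((t * s).1 : R) * a) s = toLoc S ((t.1 : R) * a) := by
  have e : ((t * s).1 : R) * a = s • ((t.1 : R) * a) := by
    rw [center_smul_def, ← mul_assoc, mul_comm t s]; rfl
  rw [e, LocalizedModule.mk_cancel]; rfl

end LocalizedModule

/-! ### Localization of form rings and its universal property -/

section Localization

variable {R R' : Type*} [Ring R] [StarRing R] [Ring R'] [StarRing R'] {lam : R} {lam' : R'}
  {Λ : FormParameter lam} {Λ' : FormParameter lam'}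

/-- The scalars of a form ring that lie in a given multiplicative set of central elements. -/
def formDenoms (Λ : FormParameter lam) (S : Submonoid (Subring.center R)) : Submonoid R where
  carrier := {t | IsFormScalar Λ t ∧ ∃ s ∈ S, (s : R) = t}
  one_mem' := ⟨.one, 1, one_mem S, rfl⟩
  mul_mem' := by
    rintro _ _ ⟨h, s, hs, rfl⟩ ⟨h', s', hs', rfl⟩
    exact ⟨h.mul h', s * s', mul_mem hs hs', rfl⟩

variable {S : Submonoid (Subring.center R)} [StarStable S]

/-- A central s need not preserve Λ, but its norm does, since s̄sa = s̄as. Norms therefore supply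
enough scalar denominators to clear every s in S. -/
theorem norm_mem_formDenoms (s : S) : ((starDenom s * s).1 : R) ∈ formDenoms Λ S := by
  refine ⟨⟨fun a => (center_comm _ a).symm, ?_, fun a ha => ?_⟩, _, (starDenom s * s).2, rfl⟩
  · change star (star (s.1 : R) * s.1) = star (s.1 : R) * s.1
    rw [star_mul, star_star]
  · change star (s.1 : R) * s.1 * a ∈ _
    rw [mul_assoc, ← center_comm, ← mul_assoc]
    exact Λ.star_mul_mul_mem _ ha

theorem starDenom_one : starDenom (1 : S) = 1 :=
  Subtype.ext (Subtype.ext (star_one R))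

theorem isFormHom_toLoc : IsFormHom Λ (Λ.loc S) (toLoc S) where
  map_star a := by rw [toLoc_apply, toLoc_apply, star_loc_mk, starDenom_one]
  map_lam := rfl
  map_mem a ha := ⟨a, ha, 1, by rw [toLoc_apply, starDenom_one, one_mul]⟩

theorem IsFormScalar.toLoc {c : R} (hc : IsFormScalar Λ c) :
    IsFormScalar (Λ.loc S) (toLoc S c) where
  comm x := by
    induction x using LocalizedModule.induction_on with
    | _ a s => rw [toLoc_mul_mk, mk_mul_toLoc, hc.comm]
  star_eq := by rw [← (isFormHom_toLoc (Λ := Λ)).map_star, hc.star_eq]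
  mul_mem := by
    rintro _ ⟨a, ha, s, rfl⟩
    exact ⟨c * a, hc.mul_mem a ha, s, toLoc_mul_mk _ _ _⟩

instance instIsCentralUnitaryLoc [IsCentralUnitary lam] : IsCentralUnitary (toLoc S lam) where
  comm x := by
    induction x using LocalizedModule.induction_on with
    | _ a s => rw [toLoc_mul_mk, mk_mul_toLoc, IsCentralUnitary.comm (lam := lam)]
  mul_star := by
    rw [toLoc_apply, star_loc_mk, starDenom_one, LocalizedModule.mk_mul_mk,
      IsCentralUnitary.mul_star, mul_one, ← toLoc_apply, map_one]

theorem isFormLocalization_toLoc (Λ : FormParameter lam) (S : Submonoid (Subring.center R))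
    [StarStable S] : IsFormLocalization Λ (Λ.loc S) (formDenoms Λ S) (toLoc S) where
  toIsFormHom := isFormHom_toLoc
  scalar _ ht := ht.1
  scalar_map _ ht := ht.1.toLoc
  exists_denom b := by
    induction b using LocalizedModule.induction_on with
    | _ a s =>
      exact ⟨_, norm_mem_formDenoms s, _, by rw [toLoc_mul_mk, mk_coe_mul]⟩
  exists_denom_mem := by
    rintro _ ⟨a, ha, s, rfl⟩
    refine ⟨_, norm_mem_formDenoms s, a, ha, ?_⟩
    rw [toLoc_mul_mk, ← center_smul_def, LocalizedModule.mk_cancel]; rfl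
  exists_mul_eq_zero a ha := by
    rw [toLoc_apply, ← LocalizedModule.zero_mk 1, LocalizedModule.mk_eq] at ha
    obtain ⟨u, hu⟩ := ha
    refine ⟨_, norm_mem_formDenoms u, ?_⟩
    simp only [one_smul, smul_zero] at hu
    rw [center_smul_def] at hu
    change star (u.1 : R) * u.1 * a = 0
    rw [mul_assoc, hu, mul_zero]

/-- The universal property of the localization of a form ring. -/
theorem IsFormHom.exists_loc_lift {f : R →+* R'} (hf : IsFormHom Λ Λ' f) (g : S → R')
    (hg : ∀ s : S, f s.1 * g s = 1) (hgc : ∀ s b, g s * b = b * g s) :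
    ∃ F : LocalizedModule S R →+* R', IsFormHom (Λ.loc S) Λ' F ∧ ∀ a, F (toLoc S a) = f a := by
  have hg' : ∀ s : S, g s * f s.1 = 1 := fun s => by rw [hgc, hg]
  have hg1 : g 1 = 1 := by
    have := hg 1
    simpa using this
  have huniq : ∀ (s : S) (x : R'), f s.1 * x = 1 → x = g s := fun s x hx => by
    rw [← one_mul x, ← hg' s, mul_assoc, hx, mul_one]
  have hgmul : ∀ s t : S, g (s * t) = g s * g t := fun s t => by
    refine (huniq _ _ ?_).symm
    change f ((s.1 : R) * t.1) * _ = 1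
    rw [map_mul, hgc s (g t), mul_assoc, ← mul_assoc (f t.1), hg t, one_mul, hg s]
  have hsmul : ∀ (s : S) a, g s * f (s • a) = f a := fun s a => by
    rw [center_smul_def, map_mul, ← mul_assoc, hg', one_mul]
  have hgstar : ∀ s : S, g (starDenom s) = star (g s) := fun s => by
    refine (huniq _ _ ?_).symm
    rw [coe_starDenom, hf.map_star, ← star_mul, hg', star_one]
  let F₀ : LocalizedModule S R → R' := fun x =>
    LocalizedModule.liftOn x (fun p => g p.2 * f p.1) (by
      rintro ⟨a, s⟩ ⟨b, t⟩ ⟨u, hu⟩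
      change g s * f a = g t * f b
      rw [← hsmul t a, ← hsmul s b, ← hsmul u (t • a), ← hsmul u (s • b), hu]
      simp only [← mul_assoc]
      rw [hgc s (g t)])
  have hF₀ : ∀ a s, F₀ (LocalizedModule.mk a s) = g s * f a := fun a s =>
    LocalizedModule.liftOn_mk _ _ _
  let F : LocalizedModule S R →+* R' :=
    { toFun := F₀
      map_one' := by
        rw [← map_one (toLoc S), toLoc_apply, hF₀, hg1, map_one, one_mul]
      map_zero' := by
        rw [← LocalizedModule.zero_mk 1, hF₀, map_zero, mul_zero]
      map_mul' := fun x y => by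
        induction x using LocalizedModule.induction_on with
        | _ a s =>
          induction y using LocalizedModule.induction_on with
          | _ b t =>
            rw [LocalizedModule.mk_mul_mk, hF₀, hF₀, hF₀, hgmul, map_mul, mul_assoc, mul_assoc,
              ← mul_assoc (f a), ← hgc t (f a), mul_assoc]
      map_add' := fun x y => by
        induction x using LocalizedModule.induction_on with
        | _ a s =>
          induction y using LocalizedModule.induction_on with
          | _ b t =>
            rw [LocalizedModule.mk_add_mk, hF₀, hF₀, hF₀, hgmul, map_add, mul_add, mul_assoc,
              hsmul, hgc s (g t), mul_assoc, hsmul] }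
  have hF : ∀ a s, F (LocalizedModule.mk a s) = g s * f a := hF₀
  have hFloc : ∀ a, F (toLoc S a) = f a := fun a => by rw [toLoc_apply, hF, hg1, one_mul]
  refine ⟨F, ⟨fun x => ?_, ?_, ?_⟩, hFloc⟩
  · induction x using LocalizedModule.induction_on with
    | _ a s => rw [star_loc_mk, hF, hF, star_mul, hgstar, hf.map_star, ← hgstar, hgc]
  · rw [hFloc, hf.map_lam]
  · rintro _ ⟨a, ha, s, rfl⟩
    -- Denominators in the localized form parameter are norms, so the image of a / (s̄s) is the
    -- conjugate of `f a` by `g s` and stays in Λ'.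
    rw [hF, hgmul, hgstar, mul_assoc, hgc, ← mul_assoc]
    exact Λ'.star_mul_mul_mem (g s) (hf.map_mem _ ha)

end Localization

/-! ### The grading as a polynomial parameter, and integrality over scalars -/

section Graded

theorem C_mul_comm_of_central {R : Type*} [Ring R] {c : R} (hc : ∀ a, c * a = a * c) (p : R[X]) :
    C c * p = p * C c := by
  ext k; rw [coeff_C_mul, coeff_mul_C, hc]

theorem mk_one_mul_comm {R : Type*} [Ring R] {S : Submonoid (Subring.center R)} (s : S)
    (x : LocalizedModule S R) : LocalizedModule.mk 1 s * x = x * LocalizedModule.mk 1 s := by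
  induction x using LocalizedModule.induction_on with
  | _ a t =>
    rw [LocalizedModule.mk_mul_mk, LocalizedModule.mk_mul_mk, one_mul, mul_one, mul_comm]

theorem mk_coe_self {R : Type*} [Ring R] {S : Submonoid (Subring.center R)} (s : S) :
    LocalizedModule.mk (s.1 : R) s = (1 : LocalizedModule S R) := by
  rw [← map_one (toLoc S), toLoc_apply, ← LocalizedModule.mk_cancel s (1 : R), center_smul_def,
    mul_one]

variable {R : Type*} [Ring R] [StarRing R] (𝒜 : ℕ → AddSubgroup R) [GradedRing 𝒜]

/-- The homomorphism `R → R[X]` multiplying each component of degree `i` by `X ^ i`. -/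
noncomputable def gradeHom {R : Type*} [Ring R] (𝒜 : ℕ → AddSubgroup R) [GradedRing 𝒜] :
    R →+* R[X] :=
  (DirectSum.toSemiring (fun i => ((monomial i : R →ₗ[R] R[X]).toAddMonoidHom).comp (𝒜 i).subtype)
    (by exact monomial_zero_one) (fun _ _ => (monomial_mul_monomial _ _ _ _).symm)).comp
    (DirectSum.decomposeRingEquiv 𝒜).toRingHom

theorem gradeHom_of_mem {R : Type*} [Ring R] (𝒜 : ℕ → AddSubgroup R) [GradedRing 𝒜] {i : ℕ}
    {a : R} (ha : a ∈ 𝒜 i) : gradeHom 𝒜 a = monomial i a := by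
  have h : (DirectSum.decomposeRingEquiv 𝒜).toRingHom a = DirectSum.of (fun i => 𝒜 i) i ⟨a, ha⟩ :=
    DirectSum.decompose_of_mem 𝒜 ha
  rw [gradeHom, RingHom.comp_apply, h]
  exact DirectSum.toSemiring_of (A := fun i => 𝒜 i) _ _ _ i ⟨a, ha⟩

theorem coeff_gradeHom {R : Type*} [Ring R] (𝒜 : ℕ → AddSubgroup R) [GradedRing 𝒜] (a : R)
    (k : ℕ) : (gradeHom 𝒜 a).coeff k = GradedRing.proj 𝒜 k a := by
  induction a using DirectSum.Decomposition.inductionOn 𝒜 with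
  | zero => simp
  | @homogeneous i a =>
    rw [gradeHom_of_mem 𝒜 a.2, coeff_monomial, GradedRing.proj_apply]
    split_ifs with h
    · subst h; rw [DirectSum.decompose_of_mem_same 𝒜 a.2]
    · rw [DirectSum.decompose_of_mem_ne 𝒜 a.2 h]
  | add a b ha hb => rw [map_add, coeff_add, ha, hb, map_add]

theorem isFormHom_gradeHom {lam : R} [IsCentralUnitary lam] {Λ : FormParameter lam}
    (h : IsGradedFormRing 𝒜 Λ) : IsFormHom Λ Λ.polynomial (gradeHom 𝒜) where
  map_star a := by
    induction a using DirectSum.Decomposition.inductionOn 𝒜 with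
    | zero => simp
    | @homogeneous i a =>
      rw [gradeHom_of_mem 𝒜 a.2, gradeHom_of_mem 𝒜 (h.star_deg i a a.2), star_monomial]
    | add a b ha hb => rw [star_add, map_add, map_add, star_add, ha, hb]
  map_lam := by rw [gradeHom_of_mem 𝒜 h.lam_deg, monomial_zero_left]
  map_mem a ha k := by rw [coeff_gradeHom]; exact h.proj_mem a ha k

variable {lam : R} {Λ : FormParameter lam}

/-- The substitution `X ↦ X + Y` from `R[X]` to `R[X][Y]`. -/
noncomputable def shiftHom (Λ : FormParameter lam) [IsCentralUnitary lam] : R[X] →+* R[X][X] :=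
  evalHom (C.comp C) ((IsFormScalar.X (Λ := Λ)).C.add IsFormScalar.X)

theorem isFormHom_shiftHom [IsCentralUnitary lam] :
    IsFormHom Λ.polynomial Λ.polynomial.polynomial (shiftHom Λ) :=
  (IsFormHom.C.comp IsFormHom.C).evalHom _

/-- Norms preserve Λ by the conjugation axiom. Traces follow by polarization: (z + z̄)a is obtained
by expanding the conjugate of a by 1 + z. -/
theorem IsFormScalar.of_center {z : R} (hz : z ∈ Subring.center R) :
    IsFormScalar Λ (z + star z) ∧ IsFormScalar Λ (star z * z) := by
  have hc : ∀ a, z * a = a * z := fun a => (Subring.mem_center_iff.mp hz a).symm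
  have hc' : ∀ a, star z * a = a * star z := fun a =>
    (Subring.mem_center_iff.mp (Set.star_mem_center hz) a).symm
  refine ⟨⟨fun a => by rw [add_mul, mul_add, hc, hc'], by rw [star_add, star_star, add_comm],
    fun a ha => ?_⟩, ⟨fun a => by rw [mul_assoc, hc, ← mul_assoc, hc', mul_assoc],
    by rw [star_mul, star_star], fun a ha => ?_⟩⟩
  · have e : (z + star z) * a = star (1 + z) * a * (1 + z) - a - star z * a * z := by
      rw [star_add, star_one, add_mul, hc]; noncomm_ring
    rw [e]
    exact Λ.sub_mem (Λ.sub_mem (Λ.star_mul_mul_mem _ ha) ha) (Λ.star_mul_mul_mem _ ha)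
  · rw [mul_assoc, hc, ← mul_assoc]
    exact Λ.star_mul_mul_mem _ ha

/-- The scalars of the form ring that lie in the centre of the degree zero part. -/
def degreeZeroScalars (Λ : FormParameter lam) : Subring (Subring.center (𝒜 0)) where
  carrier := {c | IsFormScalar Λ ((c : 𝒜 0) : R)}
  one_mem' := IsFormScalar.one
  zero_mem' := IsFormScalar.zero
  mul_mem' h h' := h.mul h'
  add_mem' h h' := h.add h'
  neg_mem' h := h.neg

/-- Each c is a root of X² - (c + c̄)X + c̄c, whose coefficients are scalars. -/
theorem isIntegral_degreeZeroScalars (h : IsGradedFormRing 𝒜 Λ)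
    (hcenter : ∀ c : Subring.center (𝒜 0), ((c : 𝒜 0) : R) ∈ Subring.center R) :
    Algebra.IsIntegral (degreeZeroScalars 𝒜 Λ) (Subring.center (𝒜 0)) := by
  refine ⟨fun c => ?_⟩
  have hstar : star ((c : 𝒜 0) : R) ∈ 𝒜 0 := h.star_deg 0 _ c.1.2
  have hstar' : (⟨_, hstar⟩ : 𝒜 0) ∈ Subring.center (𝒜 0) := by
    rw [Subring.mem_center_iff]
    intro g
    exact Subtype.ext (Subring.mem_center_iff.mp (Set.star_mem_center (hcenter c)) g)
  let c' : Subring.center (𝒜 0) := ⟨⟨_, hstar⟩, hstar'⟩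
  let b : degreeZeroScalars 𝒜 Λ := ⟨c + c', (IsFormScalar.of_center (hcenter c)).1⟩
  let d : degreeZeroScalars 𝒜 Λ := ⟨c' * c, (IsFormScalar.of_center (hcenter c)).2⟩
  refine ⟨X ^ 2 + (C (-b) * X + C d), monic_X_pow_add ?_, ?_⟩
  · exact (degree_linear_le).trans_lt (by norm_num)
  · rw [eval₂_add, eval₂_add, eval₂_mul, eval₂_X_pow, eval₂_X, eval₂_C, eval₂_C, map_neg]
    change c ^ 2 + (-(c + c') * c + c' * c) = 0
    ring

/-- The value at `X = c` of the matrix obtained by multiplying degree `i` components by `X ^ i`. -/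
noncomputable def rescale {n : ℕ} {c : R} (hc : IsFormScalar Λ c) :
    (Matrix (Fin n ⊕ Fin n) (Fin n ⊕ Fin n) R)ˣ →* (Matrix (Fin n ⊕ Fin n) (Fin n ⊕ Fin n) R)ˣ :=
  glMap _ ((evalHom (RingHom.id R) hc).comp (gradeHom 𝒜))

theorem rescale_one {n : ℕ} (α : (Matrix (Fin n ⊕ Fin n) (Fin n ⊕ Fin n) R)ˣ) :
    rescale 𝒜 (IsFormScalar.one (Λ := Λ)) α = α := by
  have e : (evalHom (RingHom.id R) (IsFormScalar.one (Λ := Λ))).comp (gradeHom 𝒜)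
      = RingHom.id R := by
    refine RingHom.ext fun a => ?_
    induction a using DirectSum.Decomposition.inductionOn 𝒜 with
    | zero => simp
    | @homogeneous i a =>
      simp [gradeHom_of_mem 𝒜 a.2, evalHom_apply]
    | add a b ha hb => rw [map_add, ha, hb, map_add]
  rw [rescale, e]
  exact Units.ext (Matrix.ext fun _ _ => rfl)

theorem rescale_zero {n : ℕ} {α : (Matrix (Fin n ⊕ Fin n) (Fin n ⊕ Fin n) R)ˣ}
    (hmod : ∀ i j, (α : Matrix (Fin n ⊕ Fin n) (Fin n ⊕ Fin n) R) i j
      - (1 : Matrix (Fin n ⊕ Fin n) (Fin n ⊕ Fin n) R) i j ∈ HomogeneousIdeal.irrelevant 𝒜) :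
    rescale 𝒜 (IsFormScalar.zero (Λ := Λ)) α = 1 := by
  refine Units.ext (Matrix.ext fun i j => ?_)
  have h := hmod i j
  rw [HomogeneousIdeal.mem_irrelevant_iff, map_sub, sub_eq_zero] at h
  rw [rescale, glMap_apply, RingHom.comp_apply, evalHom_apply, eval₂_at_zero, coeff_gradeHom, h,
    Units.val_one, Matrix.one_apply, RingHom.id_apply, GradedRing.proj_apply]
  split_ifs
  · exact DirectSum.decompose_of_mem_same 𝒜 SetLike.GradedOne.one_mem
  · simp

/-- Dilation in Y applied to γ = α(X + Y)α(X)⁻¹ makes α(X + tY)α(X)⁻¹ elementary over `R[X][Y]`;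
then X and Y are specialized to the scalars x and y. -/
theorem exists_rescale_mem_EQ [IsCentralUnitary lam] (h : IsGradedFormRing 𝒜 Λ)
    {n : ℕ} (hn : 3 ≤ n) (S : Submonoid (Subring.center R)) [StarStable S]
    (hS : ∀ s ∈ S, (s : R) ∈ 𝒜 0) (α : (Matrix (Fin n ⊕ Fin n) (Fin n ⊕ Fin n) R)ˣ)
    (hα : locMatrix S α ∈ EQ n (toLoc S lam) (Λ.loc S)) :
    ∃ t ∈ formDenoms Λ S, ∀ x y z : R, ∀ (hx : IsFormScalar Λ x) (_ : IsFormScalar Λ y)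
      (hz : IsFormScalar Λ z), z = x + t * y →
      rescale 𝒜 hz α * (rescale 𝒜 hx α)⁻¹ ∈ EQ n lam Λ := by
  have hloc := isFormLocalization_toLoc Λ S
  have hθ := isFormHom_gradeHom 𝒜 h
  set Φ : R[X][X] →+* (LocalizedModule S R)[X][X] := mapRingHom (mapRingHom (toLoc S))
  have hΦ : IsFormHom Λ.polynomial.polynomial (Λ.loc S).polynomial.polynomial Φ :=
    hloc.polynomial.polynomial.toIsFormHom
  have key : ∀ f : R[X] →+* R[X][X], IsFormHom Λ.polynomial Λ.polynomial.polynomial f →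
      (∀ a, f (C a) = C (C a)) →
      glMap (Fin n ⊕ Fin n) Φ (glMap _ f (glMap _ (gradeHom 𝒜) α))
        ∈ EQ n (C (C (toLoc S lam))) (Λ.loc S).polynomial.polynomial := by
    intro f hf hfC
    -- Elements of S have degree zero, so the grading homomorphism sends them to constants, which
    -- are invertible over the localization. The composite thus factors through S⁻¹R, where α is
    -- elementary by assumption.
    obtain ⟨F, hF, e⟩ := (hΦ.comp (hf.comp hθ)).exists_loc_lift (S := S)
      (fun s => C (C (LocalizedModule.mk 1 s)))
      (fun s => by
        simp only [RingHom.comp_apply, gradeHom_of_mem 𝒜 (hS _ s.2), monomial_zero_left, hfC, Φ,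
          coe_mapRingHom, map_C, ← C_mul, toLoc_mul_mk, mul_one, mk_coe_self, C_1])
      (fun s => C_mul_comm_of_central (C_mul_comm_of_central (mk_one_mul_comm s)))
    have := hF.map_mem_EQ hα
    have e' : F.comp (toLoc S) = Φ.comp (f.comp (gradeHom 𝒜)) := RingHom.ext e
    rw [glMap_glMap, glMap_glMap, RingHom.comp_assoc, ← e', ← glMap_glMap]
    exact this
  obtain ⟨σ, hσ⟩ : ∃ σ, σ = glMap (Fin n ⊕ Fin n) (gradeHom 𝒜) α := ⟨_, rfl⟩
  rw [← hσ] at key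
  set γ := glMap (Fin n ⊕ Fin n) (shiftHom Λ) σ * (glMap (Fin n ⊕ Fin n) C σ)⁻¹ with hγ
  have hγloc : glMap _ Φ γ ∈ EQ n (C (C (toLoc S lam))) (Λ.loc S).polynomial.polynomial := by
    have h₁ := key _ isFormHom_shiftHom fun a => by simp [shiftHom]
    have h₂ := key _ IsFormHom.C fun a => rfl
    rw [hγ, map_mul, map_inv]
    exact mul_mem h₁ (inv_mem h₂)
  have hγ₀ : glMap _ (constHom R[X]) γ = 1 := by
    have e₁ : (constHom R[X]).comp (shiftHom Λ) = C :=
      polynomial_ringHom_ext (by simp [shiftHom, constHom_apply]) (by simp [shiftHom, constHom_apply])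
    have e₂ : (constHom R[X]).comp C = C := RingHom.ext fun p => by simp [constHom_apply]
    rw [hγ, map_mul, map_inv, glMap_glMap, glMap_glMap, e₁, e₂, mul_inv_cancel]
  obtain ⟨_, ⟨t, ht, rfl⟩, hscale⟩ := hloc.polynomial.exists_scale_mem_EQ hn hγ₀ hγloc
  refine ⟨t, ht, fun x y z hx hy hz hxyz => ?_⟩
  have := ((IsFormHom.id.evalHom hx).evalHom hy).map_mem_EQ hscale
  rw [hγ, map_mul, map_mul, map_inv, map_inv] at this
  have e₁ : (evalHom (evalHom (RingHom.id R) hx) hy).comp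
      ((scaleHom (hloc.polynomial.scalar _ ⟨t, ht, rfl⟩)).comp (shiftHom Λ))
      = evalHom (RingHom.id R) hz :=
    polynomial_ringHom_ext (by simp [shiftHom, scaleHom]) (by simp [shiftHom, scaleHom, hxyz])
  have e₂ : (evalHom (evalHom (RingHom.id R) hx) hy).comp
      ((scaleHom (hloc.polynomial.scalar _ ⟨t, ht, rfl⟩)).comp C)
      = evalHom (RingHom.id R) hx :=
    polynomial_ringHom_ext (by simp [scaleHom]) (by simp [scaleHom])
  rw [glMap_glMap, glMap_glMap, glMap_glMap, glMap_glMap, RingHom.comp_assoc, RingHom.comp_assoc,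
    e₁, e₂, hσ, glMap_glMap, glMap_glMap] at this
  exact this

end Graded

/-! ### Patching over the maximal ideals -/

theorem theorem1p3 {R : Type*} [Ring R] [StarRing R] (𝒜 : ℕ → AddSubgroup R) [GradedRing 𝒜]
    (lam : R) (Λ : FormParameter lam) (hform : IsGradedFormRing 𝒜 Λ)
    (hcenter : ∀ c : Subring.center (𝒜 0), ((c : 𝒜 0) : R) ∈ Subring.center R)
    (n : ℕ) (hn : 6 ≤ 2 * n)
    (α : (Matrix (Fin n ⊕ Fin n) (Fin n ⊕ Fin n) R)ˣ) (hα : α ∈ GQ n lam Λ)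
    (hmod : ∀ i j, (α : Matrix (Fin n ⊕ Fin n) (Fin n ⊕ Fin n) R) i j
      - (1 : Matrix (Fin n ⊕ Fin n) (Fin n ⊕ Fin n) R) i j ∈ HomogeneousIdeal.irrelevant 𝒜)
    (hloc : ∀ m : MaximalSpectrum (Subring.center (𝒜 0)),
      locMatrix (maxDenoms 𝒜 m) α ∈ EQ n (toLoc (maxDenoms 𝒜 m) lam) (Λ.loc (maxDenoms 𝒜 m))) :
    α ∈ EQ n lam Λ := by
  have : IsCentralUnitary lam :=
    ⟨fun a => (Subring.mem_center_iff.mp hform.lam_center a).symm, hform.lam_norm⟩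
  have := isIntegral_degreeZeroScalars 𝒜 hform hcenter
  let I : Ideal (degreeZeroScalars 𝒜 Λ) :=
    { carrier := {t | ∀ x y z : degreeZeroScalars 𝒜 Λ, z = x + t * y →
        rescale 𝒜 z.2 α * (rescale 𝒜 x.2 α)⁻¹ ∈ EQ n lam Λ}
      zero_mem' := by
        intro x y z h
        obtain rfl : z = x := by rw [h, zero_mul, add_zero]
        rw [mul_inv_cancel]; exact one_mem _
      add_mem' := by
        intro s t hs ht x y z h
        -- Telescoping through x + ty: α(x + ty + sy)α(x)⁻¹ is the product of the increments for s,
        -- starting at x + ty, and for t, starting at x.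
        have h₁ := ht x y _ rfl
        have h₂ := hs (x + t * y) y z (by rw [h]; ring)
        simpa [mul_assoc] using mul_mem h₂ h₁
      smul_mem' := by
        intro c t ht x y z h
        exact ht x (c * y) z (by rw [h, smul_eq_mul]; ring) }
  have hI : I = ⊤ := by
    by_contra hI
    obtain ⟨M, hM, hIM⟩ := Ideal.exists_le_maximal I hI
    -- Lying over, along the integral inclusion of the scalars in C(R₀). The denominator t found at
    -- m is a scalar outside m, hence outside M, although it lies in `I` ≤ M.
    obtain ⟨m, hm, hmM⟩ := Ideal.exists_ideal_over_maximal_of_isIntegral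
      (S := Subring.center (𝒜 0)) M (by
        rw [(RingHom.injective_iff_ker_eq_bot _).mp Subtype.val_injective]; exact bot_le)
    obtain ⟨t, ⟨hts, s, ⟨⟨c, hcs, hcm⟩, -⟩, hst⟩, h⟩ := exists_rescale_mem_EQ 𝒜 hform (by omega)
      (maxDenoms 𝒜 ⟨m, hm⟩) (by rintro s ⟨⟨c, hc, -⟩, -⟩; exact hc ▸ c.1.2) α (hloc ⟨m, hm⟩)
    have hct : ((c : 𝒜 0) : R) = t := hcs.trans hst
    let t' : degreeZeroScalars 𝒜 Λ := ⟨c, by change IsFormScalar Λ _; rwa [hct]⟩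
    have ht' : t' ∈ I := fun x y z hz => h _ _ _ x.2 y.2 z.2 (by rw [hz, ← hct]; rfl)
    have : t' ∈ m.comap (algebraMap _ _) := by rw [hmM]; exact hIM ht'
    exact hcm this
  have h1 : (1 : degreeZeroScalars 𝒜 Λ) ∈ I := hI ▸ Submodule.mem_top
  have := h1 0 1 1 (by ring)
  have e₁ : rescale 𝒜 (1 : degreeZeroScalars 𝒜 Λ).2 α = α := rescale_one 𝒜 α
  have e₀ : rescale 𝒜 (0 : degreeZeroScalars 𝒜 Λ).2 α = 1 := rescale_zero 𝒜 hmod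
  rwa [e₁, e₀, inv_one, mul_one] at this
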